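/- Let $\mathcal X$ be a finite alphabet and let $P_X,P_Y$ be probability mass functions (pmfs) on $\mathcal X$ whose supports are not disjoint. Let $\lambda>0$, $D\ge 0$, $c>0$, and let $d(y^n,z^n)=\sum_{i=1}^n\rho(y_i,z_i)$ be an additive distortion measure with $\rho\ge 0$ and $\rho(a,a)=0$. Logarithms are in base 2; $\mathcal D(P\|Q)=\sum_a P(a)\log\frac{P(a)}{Q(a)}\in[0,\infty]$ is the Kullback–Leibler divergence, $P_{x^n}$ is the type (empirical pmf) of a sequence $x^n$, and $\mathcal P_n$ is the set of types of sequences of length $n$. The game. Let $n$ run through positive integers such that $N=cn$ is an integer. The defender chooses $\Lambda\subseteq\mathcal P_n\times\mathcal P_N$ and accepts $(x^n,t^N)$ when $(P_{x^n},P_{t^N})\in\Lambda$; his strategies are the $\Lambda$ such that, for every pmf $P$, the probability that independent sequences $x^n,t^N$ emitted by the memoryless source $P$ are not accepted is at most $2^{-\lambda n}$. The attacker chooses a map $f$ with $d(y^n,f(y^n,t^N))\le nD$ for all $y^n,t^N$. The attacker's payoff (the defender's loss) is the false negative probability $$P_{fn}(\Lambda,f)=\sum_{(y^n,t^N):\,(P_{f(y^n,t^N)},P_{t^N})\in\Lambda}P_Y(y^n)P_X(t^N).$$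 For pmfs $P,Q$ put $U=\frac{P+cQ}{1+c}$, $h_c(P,Q)=\mathcal D(P\|U)+c\,\mathcal D(Q\|U)$ and $$\Lambda^{*,n}=\Big\{(P,Q):h_c(P,Q)<\lambda-|\mathcal X|\tfrac{\log[(n+1)(cn+1)]}{n}\Big\},$$ and let $f^*(y^n,t^N)$ be any minimizer of $h_c(P_{z^n},P_{t^N})$ over the $z^n$ with $d(y^n,z^n)\le nD$. For a pmf $Q$ let $$\Gamma^n_{tr,c}(Q)=\{P\in\mathcal P_n:\ \forall y^n \text{ of type } P\ \exists z^n\text{ with }d(y^n,z^n)\le nD,\ (P_{z^n},Q)\in\Lambda^{*,n}\},\qquad \Gamma^\infty_{tr,c}(Q)=\mathrm{cl}\Big(\bigcup_{n\ge1}\Gamma^n_{tr,c}(Q)\Big).$$ Theorem. The profile $(\Lambda^{*,n},f^*)$ is an asymptotic equilibrium: there is $\nu_n\to0$ such that $\Lambda^{*,n}$ has false positive probability at most $2^{-n(\lambda-\nu_n)}$ for every source; $P_{fn}(\Lambda^{*,n},g)\le P_{fn}(\Lambda,g)$ for every strategy $\Lambda$ of the defender and every strategy $g$ of the attacker; and $f^*$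 is a best response to $\Lambda^{*,n}$. The false negative error exponent at this equilibrium, $\varepsilon_{tr,c}=\lim_{n\to\infty}-\frac1n\log P_{fn}(\Lambda^{*,n},f^*)$, exists, is finite, and $$\varepsilon_{tr,c}=\min_{Q}\Big[c\,\mathcal D(Q\|P_X)+\min_{P\in\Gamma^\infty_{tr,c}(Q)}\mathcal D(P\|P_Y)\Big],$$ where $Q$ ranges over all pmfs on $\mathcal X$ and all the minima are attained. Consequently $\varepsilon_{tr,c}=0$ if $P_Y\in\Gamma^\infty_{tr,c}(P_X)$, and $\varepsilon_{tr,c}>0$ if $P_Y\notin\Gamma^\infty_{tr,c}(P_X)$. -/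

import Mathlib

open Filter Topology

namespace TrainedTest

noncomputable section

variable {𝒳 : Type*} [Fintype 𝒳] [DecidableEq 𝒳]

/-- Kullback-Leibler divergence in bits, with `0 log 0 = 0` and `p log (p / 0) = ∞` for `p > 0`. -/
def kl (P Q : 𝒳 → ℝ) : EReal :=
  open scoped Classical in
  if ∃ a, P a ≠ 0 ∧ Q a = 0 then ⊤
  else ((∑ a, P a * Real.logb 2 (P a / Q a) : ℝ) : EReal)

/-- The type (empirical pmf) of a sequence of length `n`. -/
def seqType {n : ℕ} (x : Fin n → 𝒳) : 𝒳 → ℝ :=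
  fun a => ((Finset.univ.filter fun i => x i = a).card : ℝ) / n

/-- Probability that a memoryless source with pmf `P` emits the sequence `x`. -/
def seqProb (P : 𝒳 → ℝ) {n : ℕ} (x : Fin n → 𝒳) : ℝ := ∏ i, P (x i)

/-- Additive distortion with per-letter distortion `ρ`. -/
def distortion (ρ : 𝒳 → 𝒳 → ℝ) {n : ℕ} (y z : Fin n → 𝒳) : ℝ := ∑ i, ρ (y i) (z i)

/-- Generalized log-likelihood ratio `h_c(P, Q) = D(P‖U) + c D(Q‖U)`,
`U = P / (1 + c) + c Q / (1 + c)`. When `P`, `Q` are the types of sequences of lengths `n` and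
`N = c n`, `U` is the type of their concatenation. -/
def glr (c : ℝ) (P Q : 𝒳 → ℝ) : EReal :=
  let U : 𝒳 → ℝ := fun a => 1 / (1 + c) * P a + c / (1 + c) * Q a
  kl P U + (c : EReal) * kl Q U

/-- A limited-resources acceptance region: a set of pairs of pmfs, of which only the pairs
(type of the test sequence, type of the training sequence) matter. -/
abbrev Region (𝒳 : Type*) := Set ((𝒳 → ℝ) × (𝒳 → ℝ))

/-- An attack maps the sequence `y` (length `n`) and the training sequence `t` (length `N`,
shared with the defender) to a sequence of length `n`. -/
abbrev Attack (𝒳 : Type*) (n N : ℕ) := (Fin n → 𝒳) → (Fin N → 𝒳) → (Fin n → 𝒳)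

/-- False positive probability of a region: `x` and `t` are independently emitted by the source `P`
and the pair is rejected. -/
def falsePos (n N : ℕ) (P : 𝒳 → ℝ) (Λ : Region 𝒳) : ℝ :=
  open scoped Classical in
  ∑ x : Fin n → 𝒳, ∑ t : Fin N → 𝒳,
    if (seqType x, seqType t) ∈ Λ then 0 else seqProb P x * seqProb P t

/-- False negative probability of a profile (region, attack); the defender's payoff is its
opposite. -/
def falseNeg {n N : ℕ} (PX PY : 𝒳 → ℝ) (Λ : Region 𝒳) (f : Attack 𝒳 n N) : ℝ :=
  open scoped Classical in
  ∑ t : Fin N → 𝒳, ∑ y : Fin n → 𝒳,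
    if (seqType (f y t), seqType t) ∈ Λ then seqProb PY y * seqProb PX t else 0

/-- Strategies of the defender: the false positive probability is at most `2 ^ (-lam n)`
for every source over the alphabet. -/
def defenderStrategies (lam : ℝ) (n N : ℕ) : Set (Region 𝒳) :=
  {Λ | ∀ P ∈ stdSimplex ℝ 𝒳, falsePos n N P Λ ≤ (2 : ℝ) ^ (-(lam * n))}

/-- Strategies of the attacker: the total distortion is at most `n D`. -/
def attackerStrategies (ρ : 𝒳 → 𝒳 → ℝ) (D : ℝ) (n N : ℕ) : Set (Attack 𝒳 n N) :=
  {f | ∀ y t, distortion ρ y (f y t) ≤ n * D}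

/-- `lam - |𝒳| log ((n + 1) (N + 1)) / n` with `N = c n`. -/
def threshold (𝒳 : Type*) [Fintype 𝒳] (lam c : ℝ) (n : ℕ) : ℝ :=
  lam - Fintype.card 𝒳 * (Real.logb 2 (((n : ℝ) + 1) * (c * n + 1)) / n)

/-- The defender's equilibrium acceptance region, extended to arbitrary pairs of pmfs. -/
def optRegion (lam c : ℝ) (n : ℕ) : Region 𝒳 :=
  {PQ | glr c PQ.1 PQ.2 < (threshold 𝒳 lam c n : EReal)}

/-- `f` is an equilibrium attack: `f y t` minimizes `z ↦ h(z, t)` over all sequences `z` within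
distortion `n D` of `y`. -/
def IsOptAttack (ρ : 𝒳 → 𝒳 → ℝ) (D c : ℝ) {n N : ℕ} (f : Attack 𝒳 n N) : Prop :=
  ∀ y t, distortion ρ y (f y t) ≤ n * D ∧
    ∀ z, distortion ρ y z ≤ n * D → glr c (seqType (f y t)) (seqType t) ≤ glr c (seqType z) (seqType t)

/-- A sequence of profiles is an asymptotic (dominance) equilibrium of the games with lengths
`n k`, `N k`: the regions satisfy the false positive constraint with an exponent tending to `lam`,
they are at least as good for the defender as every strategy of the game whatever the attack,
and the attacks are best responses to them. -/
def IsAsymptoticEquilibrium (ρ : 𝒳 → 𝒳 → ℝ) (D lam : ℝ) (PX PY : 𝒳 → ℝ) (n N : ℕ → ℕ)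
    (Λ : ℕ → Region 𝒳) (f : ∀ k, Attack 𝒳 (n k) (N k)) : Prop :=
  (∃ ν : ℕ → ℝ, Tendsto ν atTop (𝓝 0) ∧
    ∀ k, Λ k ∈ defenderStrategies (lam - ν k) (n k) (N k)) ∧
  (∀ k, ∀ Λ' ∈ defenderStrategies lam (n k) (N k), ∀ g ∈ attackerStrategies ρ D (n k) (N k),
    falseNeg PX PY (Λ k) g ≤ falseNeg PX PY Λ' g) ∧
  (∀ k, f k ∈ attackerStrategies ρ D (n k) (N k) ∧
    ∀ g ∈ attackerStrategies ρ D (n k) (N k),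
      falseNeg PX PY (Λ k) g ≤ falseNeg PX PY (Λ k) (f k))

/-- `Γ^n(Q)`: types `P` with denominator `n` such that every sequence of type `P` can be moved,
within distortion `n D`, to a sequence whose type is accepted together with `Q`. -/
def gammaN (ρ : 𝒳 → 𝒳 → ℝ) (D lam c : ℝ) (n : ℕ) (Q : 𝒳 → ℝ) : Set (𝒳 → ℝ) :=
  {P | (∃ y : Fin n → 𝒳, seqType y = P) ∧
    ∀ y : Fin n → 𝒳, seqType y = P →
      ∃ z : Fin n → 𝒳, (seqType z, Q) ∈ (optRegion lam c n : Region 𝒳) ∧ distortion ρ y z ≤ n * D}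

/-- `Γ^∞(Q)`: closure of the union of the `Γ^n(Q)`, `n ≥ 1`. -/
def gammaInf (ρ : 𝒳 → 𝒳 → ℝ) (D lam c : ℝ) (Q : 𝒳 → ℝ) : Set (𝒳 → ℝ) :=
  closure (⋃ n ∈ Set.Ici 1, gammaN ρ D lam c n Q)

end

end TrainedTest

open TrainedTest

/-! The proof is the method of types. Sequences of lengths `n` and `N = c n` fall into polynomially
many pairs of type classes. Up to a polynomial factor, the class of types `(P, Q)` has probability
`2 ^ (-n (D(P‖R) + c D(Q‖S)))` when `y`, `t` come from sources `R`, `S`; the correction inside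
`threshold` is exactly the exponent of the number of types.

Equilibrium: `h_c(P, Q)` is the minimum over sources `V` of `D(P‖V) + c D(Q‖V)`, attained at the
mixture `U`. Hence rejecting pairs with large `h_c` is safe for every source
(`falsePos_optRegion_le`), while a strategy that rejects a single pair of types below the threshold
violates its constraint at the source `U` (`mem_of_mem_optRegion`). So the optimal region accepts no
more pairs of types than any strategy does, which gives dominance; minimizing `h_c` is then plainly
a best response.

Exponent: the success of the optimal attack depends only on the two types. Recording `(y, z)` by its
joint type turns the attack into a transport problem, and `gammaInf_eq` identifies `Γ^∞(Q)` with the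
first marginals of the compact set `transports`. Every successful class then has exponent at least
the minimum (`falseNeg_le`). Conversely a minimizer may lie on the boundary of the constraints, or
lose feasibility when rounded to types. Mixing it with a little diagonal mass costs no distortion
and multiplies the bound on `h_c` by `1 - s` (`glrReal_mix_le`), which makes it strictly feasible;
rounding then puts all excess on a free diagonal entry. A letter common to both supports keeps the
divergences finite throughout (`eventually_le_falseNeg`). -/

namespace TrainedTest

set_option linter.unusedSectionVars false

/-! ### Method of types: sizes and probabilities of type classes, rounding of pmfs. -/

section Types

variable {ι : Type*} [Fintype ι] [DecidableEq ι] {n : ℕ}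

/-- Number of occurrences of each letter in a sequence. -/
def letterCount (x : Fin n → ι) : ι → ℕ := fun a => (Finset.univ.filter fun i => x i = a).card

theorem seqType_apply (x : Fin n → ι) (a : ι) : seqType x a = (letterCount x a : ℝ) / n := rfl

theorem sum_letterCount (x : Fin n → ι) : ∑ a, letterCount x a = n := by
  have := Finset.card_eq_sum_card_fiberwise (f := x) (s := Finset.univ) (t := Finset.univ)
    (fun _ _ => Finset.mem_coe.2 (Finset.mem_univ _))
  simpa [letterCount] using this.symm

theorem letterCount_le (x : Fin n → ι) (a : ι) : letterCount x a ≤ n :=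
  (Finset.card_le_univ _).trans_eq (Fintype.card_fin n)

theorem letterCount_eq_of_seqType_eq {x y : Fin n → ι} (h : seqType x = seqType y) :
    letterCount x = letterCount y := by
  funext a
  rcases Nat.eq_zero_or_pos n with rfl | hn
  · simp [letterCount]
  · have := congrFun h a
    rw [seqType_apply, seqType_apply, div_left_inj' (by positivity)] at this
    exact_mod_cast this

theorem seqType_eq_iff {x y : Fin n → ι} : seqType x = seqType y ↔ letterCount x = letterCount y :=
  ⟨letterCount_eq_of_seqType_eq, fun h => by funext a; rw [seqType_apply, seqType_apply, h]⟩

theorem seqType_nonneg (x : Fin n → ι) (a : ι) : 0 ≤ seqType x a := by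
  rw [seqType_apply]; positivity

theorem seqType_mem_stdSimplex (hn : 0 < n) (x : Fin n → ι) : seqType x ∈ stdSimplex ℝ ι := by
  refine ⟨seqType_nonneg x, ?_⟩
  simp only [seqType_apply]
  rw [← Finset.sum_div, ← Nat.cast_sum, sum_letterCount]
  field_simp

theorem sum_letterCount_mul (x : Fin n → ι) (g : ι → ℝ) :
    ∑ a, (letterCount x a : ℝ) * g a = ∑ i, g (x i) := by
  rw [← Finset.sum_fiberwise (s := Finset.univ) (g := x) (f := fun i => g (x i))]
  refine Finset.sum_congr rfl fun a _ => ?_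
  rw [Finset.sum_congr rfl (g := fun _ => g a), Finset.sum_const, nsmul_eq_mul, letterCount]
  intro i hi
  rw [(Finset.mem_filter.1 hi).2]

theorem sum_seqType_mul (x : Fin n → ι) (g : ι → ℝ) :
    ∑ a, seqType x a * g a = (∑ i, g (x i)) / n := by
  rw [← sum_letterCount_mul, Finset.sum_div]
  exact Finset.sum_congr rfl fun a _ => by rw [seqType_apply]; ring

theorem seqType_apply_pos (x : Fin n → ι) (i : Fin n) : 0 < seqType x (x i) := by
  rw [seqType_apply]
  have h1 : 0 < letterCount x (x i) := Finset.card_pos.2 ⟨i, by simp⟩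
  have : 0 < n := i.pos
  positivity

theorem exists_of_seqType_ne_zero {x : Fin n → ι} {a : ι} (h : seqType x a ≠ 0) :
    ∃ i, x i = a := by
  by_contra! hc
  apply h
  have : letterCount x a = 0 := Finset.card_eq_zero.2 (Finset.filter_eq_empty_iff.2 fun i _ => hc i)
  rw [seqType_apply, this]; simp

theorem letterCount_comp_perm (x : Fin n → ι) (σ : Equiv.Perm (Fin n)) :
    letterCount (x ∘ σ) = letterCount x := by
  funext a
  refine Finset.card_bij (fun i _ => σ i) ?_ (fun _ _ _ _ h => σ.injective h) ?_
  · intro i hi; simpa using hi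
  · intro i hi; exact ⟨σ.symm i, by simpa using hi, by simp⟩

theorem seqType_comp_perm (x : Fin n → ι) (σ : Equiv.Perm (Fin n)) :
    seqType (x ∘ σ) = seqType x :=
  seqType_eq_iff.2 (letterCount_comp_perm x σ)

theorem exists_perm_of_letterCount_eq {x y : Fin n → ι} (h : letterCount x = letterCount y) :
    ∃ σ : Equiv.Perm (Fin n), x = y ∘ σ := by
  have e : ∀ a, {i // x i = a} ≃ {i // y i = a} := fun a =>
    Fintype.equivOfCardEq (by
      rw [Fintype.card_subtype, Fintype.card_subtype]; exact congrFun h a)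
  exact ⟨Equiv.ofFiberEquiv e, funext fun i => (Equiv.ofFiberEquiv_map e i).symm⟩

theorem exists_perm_of_seqType_eq {x y : Fin n → ι} (h : seqType x = seqType y) :
    ∃ σ : Equiv.Perm (Fin n), x = y ∘ σ :=
  exists_perm_of_letterCount_eq (letterCount_eq_of_seqType_eq h)

theorem exists_letterCount_eq (κ : ι → ℕ) (hκ : ∑ a, κ a = n) :
    ∃ x : Fin n → ι, letterCount x = κ := by
  have e : Fin n ≃ (Σ a, Fin (κ a)) := (Fintype.equivFinOfCardEq (by simp [hκ])).symm
  refine ⟨fun i => (e i).1, funext fun a => ?_⟩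
  rw [letterCount, ← Fintype.card_subtype, ← Fintype.card_fin (κ a)]
  refine Fintype.card_congr ((e.subtypeEquiv (q := fun s => s.1 = a) fun _ => Iff.rfl).trans ?_)
  exact Equiv.sigmaSubtype a

/-- Orbit-stabilizer: `σ ↦ x ∘ σ` maps the permutations onto the type class of `x`, and each fibre
is a coset of the stabilizer of `x`, which permutes the occurrences of each letter separately. -/
theorem card_typeClass_mul (x : Fin n → ι) :
    (Finset.univ.filter fun y : Fin n → ι => letterCount y = letterCount x).card *
      ∏ a, (letterCount x a).factorial = n.factorial := by
  have h1 : (Finset.univ : Finset (Equiv.Perm (Fin n))).card = n.factorial := by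
    simp [Fintype.card_perm]
  rw [← h1, Finset.card_eq_sum_card_fiberwise (f := fun σ : Equiv.Perm (Fin n) => x ∘ σ)
    (t := Finset.univ.filter fun y : Fin n → ι => letterCount y = letterCount x)
    (by intro σ _; simp [letterCount_comp_perm]), Finset.sum_const_nat]
  intro y hy
  obtain ⟨τ, rfl⟩ := exists_perm_of_letterCount_eq (Finset.mem_filter.1 hy).2
  have h2 := DomMulAct.stabilizer_card x
  simp only [letterCount, ← Fintype.card_subtype] at h2 ⊢
  rw [← h2]
  refine Fintype.card_congr ((Equiv.mulRight τ⁻¹).subtypeEquiv fun σ => ?_)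
  rw [Equiv.coe_mulRight]
  constructor
  · intro h
    funext i
    have := congrFun h (τ⁻¹ i)
    simpa using this
  · intro h
    funext i
    have := congrFun h (τ i)
    simpa using this

/-- The larger factorial is the smaller one times `|k - j|` factors, which are at most `k` if `j ≤
k` and exceed `k` otherwise. Multiplied over letters, this compares two type classes. -/
theorem factorial_mul_pow_le (k j : ℕ) : k.factorial * k ^ j ≤ j.factorial * k ^ k := by
  rcases le_total k j with h | h
  · calc k.factorial * k ^ j = k.factorial * k ^ (j - k) * k ^ k := by
          rw [mul_assoc, ← pow_add, Nat.sub_add_cancel h]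
      _ ≤ _ := Nat.mul_le_mul_right _ (Nat.factorial_mul_pow_sub_le_factorial h)
  · have : k.factorial ≤ j.factorial * k ^ (k - j) := by
      obtain ⟨d, rfl⟩ := Nat.exists_eq_add_of_le h
      rw [Nat.add_sub_cancel_left]
      rw [← Nat.factorial_mul_ascFactorial]
      exact Nat.mul_le_mul_left _ (Nat.ascFactorial_le_pow_add j d)
    calc k.factorial * k ^ j ≤ j.factorial * k ^ (k - j) * k ^ j := Nat.mul_le_mul_right _ this
      _ = _ := by rw [mul_assoc, ← pow_add, Nat.sub_add_cancel h]

theorem seqProb_eq_prod_pow (P : ι → ℝ) (x : Fin n → ι) :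
    seqProb P x = ∏ a, P a ^ letterCount x a := by
  rw [seqProb, ← Finset.prod_fiberwise (s := Finset.univ) (g := x)]
  refine Finset.prod_congr rfl fun a _ => ?_
  rw [Finset.prod_congr rfl (g := fun _ => P a), Finset.prod_const, letterCount]
  intro i hi
  rw [(Finset.mem_filter.1 hi).2]

theorem seqProb_nonneg {P : ι → ℝ} (hP : ∀ a, 0 ≤ P a) (x : Fin n → ι) : 0 ≤ seqProb P x :=
  Finset.prod_nonneg fun _ _ => hP _

theorem seqProb_seqType_pos (x : Fin n → ι) : 0 < seqProb (seqType x) x :=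
  Finset.prod_pos fun i _ => seqType_apply_pos x i

theorem sum_seqProb {P : ι → ℝ} (hP : P ∈ stdSimplex ℝ ι) (n : ℕ) :
    ∑ x : Fin n → ι, seqProb P x = 1 := by
  simp only [seqProb]
  rw [← Fintype.piFinset_univ, Finset.sum_prod_piFinset Finset.univ (fun _ a => P a)]
  simp [hP.2]

theorem seqProb_congr_type (P : ι → ℝ) {x y : Fin n → ι} (h : letterCount x = letterCount y) :
    seqProb P x = seqProb P y := by
  rw [seqProb_eq_prod_pow, seqProb_eq_prod_pow, h]

/-- A memoryless source is uniform on the type class of `x`. -/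
theorem sum_typeClass (P : ι → ℝ) (x : Fin n → ι) :
    ∑ y : Fin n → ι with letterCount y = letterCount x, seqProb P y =
      (Finset.univ.filter fun y : Fin n → ι => letterCount y = letterCount x).card *
        seqProb P x := by
  rw [Finset.sum_congr rfl (g := fun _ => seqProb P x), Finset.sum_const, nsmul_eq_mul]
  intro y hy
  exact seqProb_congr_type P (Finset.mem_filter.1 hy).2

/-- Among all type classes, the one of `x` is the most likely under the type of `x`. -/
theorem sum_typeClass_le (x y : Fin n → ι) :
    ∑ z : Fin n → ι with letterCount z = letterCount y, seqProb (seqType x) z ≤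
      ∑ z : Fin n → ι with letterCount z = letterCount x, seqProb (seqType x) z := by
  rw [sum_typeClass, sum_typeClass]
  have hx := card_typeClass_mul x
  have hy := card_typeClass_mul y
  set A := (Finset.univ.filter fun z : Fin n → ι => letterCount z = letterCount x).card
  set B := (Finset.univ.filter fun z : Fin n → ι => letterCount z = letterCount y).card
  have key : (∏ a, (letterCount x a).factorial) * ∏ a, letterCount x a ^ letterCount y a ≤
      (∏ a, (letterCount y a).factorial) * ∏ a, letterCount x a ^ letterCount x a := by
    rw [← Finset.prod_mul_distrib, ← Finset.prod_mul_distrib]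
    exact Finset.prod_le_prod' fun a _ => factorial_mul_pow_le _ _
  have hprob : ∀ z : Fin n → ι, seqProb (seqType x) z =
      ((∏ a, letterCount x a ^ letterCount z a : ℕ) : ℝ) / (n : ℝ) ^ n := by
    intro z
    rw [seqProb_eq_prod_pow]
    simp only [seqType_apply, div_pow]
    rw [Finset.prod_div_distrib, Finset.prod_pow_eq_pow_sum, sum_letterCount]
    push_cast
    rfl
  rw [hprob, hprob, ← mul_div_assoc, ← mul_div_assoc]
  refine div_le_div_of_nonneg_right ?_ (by positivity)
  have hpx : 0 < ∏ a, (letterCount x a).factorial := Finset.prod_pos fun a _ => Nat.factorial_pos _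
  have hpy : 0 < ∏ a, (letterCount y a).factorial := Finset.prod_pos fun a _ => Nat.factorial_pos _
  set F := ∏ a, (letterCount x a).factorial
  set G := ∏ a, (letterCount y a).factorial
  have : B * (∏ a, letterCount x a ^ letterCount y a) ≤
      A * ∏ a, letterCount x a ^ letterCount x a := by
    -- Multiplying by both products of factorials replaces the unknown class sizes by `n!`.
    refine Nat.le_of_mul_le_mul_left ?_ (Nat.mul_pos hpx hpy)
    calc F * G * (B * (∏ a, letterCount x a ^ letterCount y a))
        = (B * G) * (F * (∏ a, letterCount x a ^ letterCount y a)) := by ring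
      _ ≤ (B * G) * (G * ∏ a, letterCount x a ^ letterCount x a) := Nat.mul_le_mul_left _ key
      _ = (A * F) * (G * ∏ a, letterCount x a ^ letterCount x a) := by rw [hx, hy]
      _ = _ := by ring
  exact_mod_cast this

theorem card_image_letterCount_le (n : ℕ) :
    (Finset.univ.image (letterCount : (Fin n → ι) → ι → ℕ)).card ≤ (n + 1) ^ Fintype.card ι := by
  calc _ ≤ (Fintype.piFinset fun _ : ι => Finset.range (n + 1)).card := by
        refine Finset.card_le_card fun κ hκ => ?_
        obtain ⟨x, -, rfl⟩ := Finset.mem_image.1 hκ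
        simp [Fintype.mem_piFinset, letterCount_le]
    _ = _ := by simp

theorem sum_eq_sum_types (g : (Fin n → ι) → ℝ) :
    ∑ x, g x = ∑ κ ∈ Finset.univ.image (letterCount : (Fin n → ι) → ι → ℕ),
      ∑ x : Fin n → ι with letterCount x = κ, g x :=
  (Finset.sum_fiberwise_of_maps_to (fun x _ => Finset.mem_image_of_mem _ (Finset.mem_univ x)) _).symm

/-- Total mass one is spread over at most `(n + 1) ^ |ι|` classes, of which that of `x` is the
heaviest. -/
theorem one_le_mul_sum_typeClass (hn : 0 < n) (x : Fin n → ι) :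
    1 ≤ ((n : ℝ) + 1) ^ Fintype.card ι *
      ∑ z : Fin n → ι with letterCount z = letterCount x, seqProb (seqType x) z := by
  set S := ∑ z : Fin n → ι with letterCount z = letterCount x, seqProb (seqType x) z
  have hS : 0 ≤ S := Finset.sum_nonneg fun z _ => seqProb_nonneg (seqType_nonneg x) z
  calc (1 : ℝ) = ∑ z : Fin n → ι, seqProb (seqType x) z :=
        (sum_seqProb (seqType_mem_stdSimplex hn x) n).symm
    _ ≤ ∑ κ ∈ Finset.univ.image (letterCount : (Fin n → ι) → ι → ℕ), S := by
        rw [sum_eq_sum_types]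
        refine Finset.sum_le_sum fun κ hκ => ?_
        obtain ⟨y, -, rfl⟩ := Finset.mem_image.1 hκ
        exact sum_typeClass_le x y
    _ ≤ _ := by
        rw [Finset.sum_const, nsmul_eq_mul]
        refine mul_le_mul_of_nonneg_right ?_ hS
        exact_mod_cast card_image_letterCount_le n

/-- Within one type class the summand comes from a single pmf, so each class contributes at most
one. -/
theorem sum_seqProb_seqType_le (hn : 0 < n) :
    ∑ x : Fin n → ι, seqProb (seqType x) x ≤ ((n : ℝ) + 1) ^ Fintype.card ι := by
  rw [sum_eq_sum_types]
  calc _ ≤ ∑ κ ∈ Finset.univ.image (letterCount : (Fin n → ι) → ι → ℕ), (1 : ℝ) := by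
        refine Finset.sum_le_sum fun κ hκ => ?_
        obtain ⟨y, -, rfl⟩ := Finset.mem_image.1 hκ
        rw [← sum_seqProb (seqType_mem_stdSimplex hn y) n]
        rw [Finset.sum_congr rfl (g := fun x => seqProb (seqType y) x)]
        · exact Finset.sum_le_univ_sum_of_nonneg fun x => seqProb_nonneg (seqType_nonneg y) x
        · intro x hx
          rw [seqType_eq_iff.2 (Finset.mem_filter.1 hx).2]
    _ ≤ _ := by
        rw [Finset.sum_const, nsmul_eq_mul, mul_one]
        exact_mod_cast card_image_letterCount_le n

/-- Rounding a pmf to a type: every letter but `e` is rounded down. -/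
theorem exists_seqType_near {W : ι → ℝ} (hW : W ∈ stdSimplex ℝ ι) (e : ι) (hn : 0 < n) :
    ∃ x : Fin n → ι, (∀ a, a ≠ e → seqType x a ≤ W a) ∧
      ∀ a, |seqType x a - W a| ≤ (Fintype.card ι : ℝ) / n := by
  have hn' : (0 : ℝ) < n := by positivity
  have hcard : 1 ≤ Fintype.card ι := Fintype.card_pos_iff.2 ⟨e⟩
  have hfl : ∀ a, (⌊n * W a⌋₊ : ℝ) ≤ n * W a := fun a =>
    Nat.floor_le (mul_nonneg hn'.le (hW.1 a))
  have hsplit := Finset.sum_erase_add Finset.univ W (Finset.mem_univ e)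
  rw [hW.2] at hsplit
  have hsum : ∑ a ∈ Finset.univ.erase e, ⌊n * W a⌋₊ ≤ n := by
    have : ((∑ a ∈ Finset.univ.erase e, ⌊n * W a⌋₊ : ℕ) : ℝ) ≤ n := by
      push_cast
      calc _ ≤ ∑ a ∈ Finset.univ.erase e, n * W a := Finset.sum_le_sum fun a _ => hfl a
        _ = n * ∑ a ∈ Finset.univ.erase e, W a := by rw [Finset.mul_sum]
        _ ≤ n * 1 := mul_le_mul_of_nonneg_left (by linarith [hW.1 e]) hn'.le
        _ = n := mul_one _
    exact_mod_cast this
  set s := ∑ a ∈ Finset.univ.erase e, ⌊n * W a⌋₊ with hs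
  obtain ⟨x, hx⟩ := exists_letterCount_eq (n := n)
    -- The letter `e` absorbs whatever the other floors leave, fewer than `|ι|` units too many.
    (fun a => if a = e then n - s else ⌊n * W a⌋₊) (by
      rw [← Finset.sum_erase_add _ _ (Finset.mem_univ e), if_pos rfl,
        Finset.sum_congr rfl (g := fun a => ⌊n * W a⌋₊), ← hs, Nat.add_sub_cancel' hsum]
      intro a ha
      rw [if_neg (Finset.ne_of_mem_erase ha)])
  have hxa : ∀ a, a ≠ e → seqType x a = (⌊n * W a⌋₊ : ℝ) / n := fun a ha => by
    simp [seqType_apply, hx, ha]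
  have hxe : seqType x e = ((n : ℝ) - s) / n := by
    simp [seqType_apply, hx, Nat.cast_sub hsum]
  refine ⟨x, fun a ha => ?_, fun a => ?_⟩
  · rw [hxa a ha, div_le_iff₀ hn']; linarith [hfl a]
  by_cases ha : a = e
  · subst ha
    have h1 : (s : ℝ) ≤ n * (1 - W a) := by
      rw [hs]; push_cast
      calc _ ≤ ∑ b ∈ Finset.univ.erase a, n * W b := Finset.sum_le_sum fun b _ => hfl b
        _ = n * ∑ b ∈ Finset.univ.erase a, W b := by rw [Finset.mul_sum]
        _ = _ := by rw [← hsplit]; ring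
    have h2 : n * (1 - W a) ≤ s + Fintype.card ι := by
      rw [hs]; push_cast
      calc n * (1 - W a) = ∑ b ∈ Finset.univ.erase a, n * W b := by
            rw [← Finset.mul_sum, ← hsplit]; ring
        _ ≤ ∑ b ∈ Finset.univ.erase a, ((⌊n * W b⌋₊ : ℝ) + 1) :=
            Finset.sum_le_sum fun b _ => (Nat.lt_floor_add_one _).le
        _ ≤ _ := by
            rw [Finset.sum_add_distrib, Finset.sum_const, nsmul_eq_mul, mul_one]
            gcongr
            exact Finset.card_le_univ _
    have h3 : seqType x a - W a = (n * (1 - W a) - s) / n := by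
      rw [hxe]; field_simp; ring
    rw [h3, abs_of_nonneg (div_nonneg (by linarith) hn'.le)]
    exact div_le_div_of_nonneg_right (by linarith) hn'.le
  · have h3 : W a - seqType x a = (n * W a - ⌊n * W a⌋₊) / n := by
      rw [hxa a ha]; field_simp
    have h4 : (1 : ℝ) ≤ Fintype.card ι := by exact_mod_cast hcard
    rw [abs_sub_comm, h3, abs_of_nonneg (div_nonneg (by linarith [hfl a]) hn'.le)]
    exact div_le_div_of_nonneg_right (by linarith [Nat.lt_floor_add_one (n * W a)]) hn'.le

end Types

/-! ### Divergence and the generalized likelihood ratio as real functions. -/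

section Divergence

variable {ι : Type*} [Fintype ι] [DecidableEq ι] {n : ℕ}

/-- Real-valued divergence in bits; it agrees with `kl P Q` when `P` vanishes where `Q` does. -/
noncomputable def klReal (P Q : ι → ℝ) : ℝ := ∑ a, P a * Real.logb 2 (P a / Q a)

theorem kl_eq_coe {P Q : ι → ℝ} (h : ∀ a, Q a = 0 → P a = 0) : kl P Q = (klReal P Q : EReal) := by
  rw [kl, if_neg, klReal]
  rintro ⟨a, h1, h2⟩
  exact h1 (h a h2)

theorem kl_eq_top {P Q : ι → ℝ} (h : ¬ ∀ a, Q a = 0 → P a = 0) : kl P Q = ⊤ := by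
  push Not at h
  obtain ⟨a, h1, h2⟩ := h
  rw [kl, if_pos ⟨a, h2, h1⟩]

/-- `klFun` adds the correction `Q a - P a` to each term, which makes it nonnegative and sums to
zero for pmfs. Gibbs' inequality and its equality case follow. -/
theorem log_two_mul_klReal {P Q : ι → ℝ} (hP : P ∈ stdSimplex ℝ ι) (hQ : Q ∈ stdSimplex ℝ ι)
    (h : ∀ a, Q a = 0 → P a = 0) :
    Real.log 2 * klReal P Q = ∑ a, Q a * InformationTheory.klFun (P a / Q a) := by
  have h2 : Real.log 2 ≠ 0 := (Real.log_pos one_lt_two).ne'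
  have hterm : ∀ a, Q a * InformationTheory.klFun (P a / Q a) =
      Real.log 2 * (P a * Real.logb 2 (P a / Q a)) + (Q a - P a) := by
    intro a
    by_cases ha : Q a = 0
    · simp [ha, h a ha]
    · rw [InformationTheory.klFun_apply, Real.logb]
      field_simp
      ring
  simp only [hterm]
  rw [Finset.sum_add_distrib, Finset.sum_sub_distrib, hP.2, hQ.2, ← Finset.mul_sum, klReal]
  ring

theorem klReal_nonneg {P Q : ι → ℝ} (hP : P ∈ stdSimplex ℝ ι) (hQ : Q ∈ stdSimplex ℝ ι)
    (h : ∀ a, Q a = 0 → P a = 0) : 0 ≤ klReal P Q := by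
  have h2 : 0 < Real.log 2 := Real.log_pos one_lt_two
  refine nonneg_of_mul_nonneg_right ?_ h2
  rw [log_two_mul_klReal hP hQ h]
  exact Finset.sum_nonneg fun a _ =>
    mul_nonneg (hQ.1 a) (InformationTheory.klFun_nonneg (div_nonneg (hP.1 a) (hQ.1 a)))

theorem eq_of_klReal_eq_zero {P Q : ι → ℝ} (hP : P ∈ stdSimplex ℝ ι) (hQ : Q ∈ stdSimplex ℝ ι)
    (h : ∀ a, Q a = 0 → P a = 0) (h0 : klReal P Q = 0) : P = Q := by
  have hs := log_two_mul_klReal hP hQ h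
  rw [h0, mul_zero, eq_comm, Finset.sum_eq_zero_iff_of_nonneg fun a _ =>
    mul_nonneg (hQ.1 a) (InformationTheory.klFun_nonneg (div_nonneg (hP.1 a) (hQ.1 a)))] at hs
  funext a
  rcases mul_eq_zero.1 (hs a (Finset.mem_univ a)) with h1 | h1
  · rw [h1, h a h1]
  · rw [InformationTheory.klFun_eq_zero_iff (div_nonneg (hP.1 a) (hQ.1 a))] at h1
    exact (div_eq_one_iff_eq fun hQa => by simp [hQa] at h1).1 h1

theorem klReal_self (P : ι → ℝ) : klReal P P = 0 := by
  refine Finset.sum_eq_zero fun a _ => ?_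
  by_cases h : P a = 0 <;> simp [h]

/-- Division by zero gives zero, so letters outside the support of `Q` contribute nothing. The
support condition must therefore be carried separately wherever `klReal` stands for `kl`. -/
theorem continuous_klReal (Q : ι → ℝ) : Continuous fun P => klReal P Q := by
  refine continuous_finsetSum _ fun a _ => ?_
  by_cases ha : Q a = 0
  · simp [ha, continuous_const]
  · have : (fun P : ι → ℝ => P a * Real.logb 2 (P a / Q a)) =
        fun P => (Q a / Real.log 2) * ((P a / Q a) * Real.log (P a / Q a)) := by
      funext P
      rw [Real.logb]
      field_simp
    rw [this]
    exact continuous_const.mul (Real.continuous_mul_log.comp (by fun_prop))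

/-- Real-valued generalized log-likelihood ratio, in terms of `x log x`. -/
noncomputable def glrReal (c : ℝ) (P Q : ι → ℝ) : ℝ :=
  ∑ a, (P a * Real.log (P a) + c * (Q a * Real.log (Q a)) - (1 + c) *
    ((1 / (1 + c) * P a + c / (1 + c) * Q a) *
      Real.log (1 / (1 + c) * P a + c / (1 + c) * Q a))) / Real.log 2

/-- The form in `x log x` has no quotients, so continuity is joint and extends to the boundary of
the simplex. -/
theorem continuous_glrReal (c : ℝ) :
    Continuous fun PQ : (ι → ℝ) × (ι → ℝ) => glrReal c PQ.1 PQ.2 := by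
  refine continuous_finsetSum _ fun a _ => ?_
  have h := Real.continuous_mul_log
  have h1 : Continuous fun PQ : (ι → ℝ) × (ι → ℝ) => PQ.1 a * Real.log (PQ.1 a) :=
    h.comp (g := fun x => x * Real.log x) (f := fun PQ : (ι → ℝ) × (ι → ℝ) => PQ.1 a) (by fun_prop)
  have h2 : Continuous fun PQ : (ι → ℝ) × (ι → ℝ) => PQ.2 a * Real.log (PQ.2 a) :=
    h.comp (g := fun x => x * Real.log x) (f := fun PQ : (ι → ℝ) × (ι → ℝ) => PQ.2 a) (by fun_prop)
  have h3 : Continuous fun PQ : (ι → ℝ) × (ι → ℝ) =>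
      (1 / (1 + c) * PQ.1 a + c / (1 + c) * PQ.2 a) *
      Real.log (1 / (1 + c) * PQ.1 a + c / (1 + c) * PQ.2 a) :=
    h.comp (g := fun x => x * Real.log x)
      (f := fun PQ : (ι → ℝ) × (ι → ℝ) => 1 / (1 + c) * PQ.1 a + c / (1 + c) * PQ.2 a)
      (by fun_prop)
  fun_prop

theorem tendsto_glrReal (c : ℝ) {α : Type*} {l : Filter α} {p q : α → ι → ℝ} {P Q : ι → ℝ}
    (hp : Tendsto p l (𝓝 P)) (hq : Tendsto q l (𝓝 Q)) :
    Tendsto (fun k => glrReal c (p k) (q k)) l (𝓝 (glrReal c P Q)) := by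
  have h := ((continuous_glrReal c).tendsto (P, Q)).comp (hp.prodMk_nhds hq)
  simpa only [Function.comp_def] using h

variable {c : ℝ}

theorem mixture_eq_zero (hc : 0 < c) {p q : ℝ} (hp : 0 ≤ p) (hq : 0 ≤ q)
    (h : 1 / (1 + c) * p + c / (1 + c) * q = 0) : p = 0 ∧ q = 0 := by
  have h1 : 0 ≤ 1 / (1 + c) * p := by positivity
  have h2 : 0 ≤ c / (1 + c) * q := by positivity
  have e1 : 1 / (1 + c) * p = 0 := by linarith
  have e2 : c / (1 + c) * q = 0 := by linarith
  have : 1 + c ≠ 0 := by positivity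
  simp_all [hc.ne']

theorem mixture_mem_stdSimplex (hc : 0 < c) {P Q : ι → ℝ} (hP : P ∈ stdSimplex ℝ ι)
    (hQ : Q ∈ stdSimplex ℝ ι) :
    (fun a => 1 / (1 + c) * P a + c / (1 + c) * Q a) ∈ stdSimplex ℝ ι := by
  refine ⟨fun a => ?_, ?_⟩
  · have := hP.1 a; have := hQ.1 a; positivity
  · rw [Finset.sum_add_distrib, ← Finset.mul_sum, ← Finset.mul_sum, hP.2, hQ.2]
    field_simp

theorem mul_logb_div_eq {p u : ℝ} (h : u = 0 → p = 0) :
    p * Real.logb 2 (p / u) = (p * Real.log p - p * Real.log u) / Real.log 2 := by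
  by_cases hp : p = 0
  · simp [hp]
  · rw [Real.logb, Real.log_div hp (fun hu => hp (h hu))]; ring

theorem glrReal_eq_klReal (hc : 0 < c) {P Q : ι → ℝ} (hP : ∀ a, 0 ≤ P a) (hQ : ∀ a, 0 ≤ Q a) :
    glrReal c P Q = klReal P (fun a => 1 / (1 + c) * P a + c / (1 + c) * Q a) +
      c * klReal Q (fun a => 1 / (1 + c) * P a + c / (1 + c) * Q a) := by
  rw [klReal, klReal, Finset.mul_sum, ← Finset.sum_add_distrib, glrReal]
  refine Finset.sum_congr rfl fun a _ => ?_
  rw [mul_logb_div_eq fun h => (mixture_eq_zero hc (hP a) (hQ a) h).1,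
    mul_logb_div_eq fun h => (mixture_eq_zero hc (hP a) (hQ a) h).2]
  generalize Real.log (1 / (1 + c) * P a + c / (1 + c) * Q a) = L
  have : 1 + c ≠ 0 := by positivity
  field_simp
  ring

theorem glr_eq_coe (hc : 0 < c) {P Q : ι → ℝ} (hP : ∀ a, 0 ≤ P a) (hQ : ∀ a, 0 ≤ Q a) :
    glr c P Q = (glrReal c P Q : EReal) := by
  rw [glrReal_eq_klReal hc hP hQ, glr, kl_eq_coe fun a h => (mixture_eq_zero hc (hP a) (hQ a) h).1,
    kl_eq_coe fun a h => (mixture_eq_zero hc (hP a) (hQ a) h).2]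
  norm_cast

/-- The mixture minimizes the total divergence. -/
theorem glrReal_le_klReal (hc : 0 < c) {P Q V : ι → ℝ} (hP : P ∈ stdSimplex ℝ ι)
    (hQ : Q ∈ stdSimplex ℝ ι) (hV : V ∈ stdSimplex ℝ ι)
    (hPV : ∀ a, V a = 0 → P a = 0) (hQV : ∀ a, V a = 0 → Q a = 0) :
    glrReal c P Q ≤ klReal P V + c * klReal Q V := by
  have h0 := klReal_nonneg (mixture_mem_stdSimplex hc hP hQ) hV
    (fun a h => by rw [hPV a h, hQV a h]; simp)
  -- Compensation identity: the excess over the minimum is `(1 + c) D(U‖V)`.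
  have h1 : klReal P V + c * klReal Q V - glrReal c P Q = (1 + c) *
      klReal (fun a => 1 / (1 + c) * P a + c / (1 + c) * Q a) V := by
    rw [klReal, klReal, klReal, glrReal, Finset.mul_sum, Finset.mul_sum, ← Finset.sum_add_distrib,
      ← Finset.sum_sub_distrib]
    refine Finset.sum_congr rfl fun a _ => ?_
    rw [mul_logb_div_eq (hPV a), mul_logb_div_eq (hQV a),
      mul_logb_div_eq (p := 1 / (1 + c) * P a + c / (1 + c) * Q a)
        (fun h => by rw [hPV a h, hQV a h]; simp)]
    generalize Real.log (1 / (1 + c) * P a + c / (1 + c) * Q a) = L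
    have : 1 + c ≠ 0 := by positivity
    field_simp
    ring
  have : 0 ≤ (1 + c) * klReal (fun a => 1 / (1 + c) * P a + c / (1 + c) * Q a) V :=
    mul_nonneg (by linarith) h0
  linarith

/-- This is the log-sum inequality for the pairs `(p, u)` and `(s, s)`, the second of which
contributes `s log 1 = 0`. Bounding the logarithm by its tangent on each pair, the errors add up to
`r (u + s) - (p + s) = 0`. -/
theorem add_mul_log_div_le {p u s : ℝ} (hp : 0 ≤ p) (hu : 0 ≤ u) (hs : 0 ≤ s)
    (h : u = 0 → p = 0) :
    (p + s) * Real.log ((p + s) / (u + s)) ≤ p * Real.log (p / u) := by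
  rcases hp.eq_or_lt with rfl | hp
  · rcases hs.eq_or_lt with rfl | hs
    · simp
    · have : Real.log ((0 + s) / (u + s)) ≤ 0 :=
        Real.log_nonpos (by positivity) (by rw [div_le_one (by positivity)]; linarith)
      simpa using mul_nonpos_of_nonneg_of_nonpos hs.le (by simpa using this)
  have hu : 0 < u := hu.lt_of_ne fun h0 => hp.ne' (h h0.symm)
  set r := (p + s) / (u + s) with hr
  have hr0 : 0 < r := by positivity
  have h1 : p * (Real.log r - Real.log (p / u)) ≤ u * r - p := by
    have := Real.log_le_sub_one_of_pos (x := r / (p / u)) (by positivity)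
    rw [Real.log_div (by positivity) (by positivity)] at this
    calc _ ≤ p * (r / (p / u) - 1) := mul_le_mul_of_nonneg_left this hp.le
      _ = _ := by field_simp
  have h2 : s * Real.log r ≤ s * (r - 1) :=
    mul_le_mul_of_nonneg_left (Real.log_le_sub_one_of_pos hr0) hs
  have h3 : r * (u + s) = p + s := by rw [hr]; field_simp
  nlinarith

/-- Mixing both arguments with a common measure decreases the generalized likelihood ratio. -/
theorem glrReal_mix_le (hc : 0 < c) {P Q S : ι → ℝ} (hP : ∀ a, 0 ≤ P a) (hQ : ∀ a, 0 ≤ Q a)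
    (hS : ∀ a, 0 ≤ S a) {e : ℝ} (he0 : 0 ≤ e) (he1 : e < 1) :
    glrReal c ((1 - e) • P + e • S) ((1 - e) • Q + e • S) ≤ (1 - e) * glrReal c P Q := by
  have he : 0 < 1 - e := by linarith
  have hmix : ∀ R : ι → ℝ, (∀ a, 0 ≤ R a) → ∀ a, 0 ≤ ((1 - e) • R + e • S) a := fun R hR a => by
    have := hR a; have := hS a; simp only [Pi.add_apply, Pi.smul_apply, smul_eq_mul]; positivity
  rw [glrReal_eq_klReal hc (hmix P hP) (hmix Q hQ), glrReal_eq_klReal hc hP hQ, klReal, klReal,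
    klReal, klReal, Finset.mul_sum, Finset.mul_sum, ← Finset.sum_add_distrib,
    ← Finset.sum_add_distrib, Finset.mul_sum]
  refine Finset.sum_le_sum fun a _ => ?_
  set u := 1 / (1 + c) * P a + c / (1 + c) * Q a with hu
  have hc1 : 1 + c ≠ 0 := by positivity
  have hu0 : 0 ≤ u := by have := hP a; have := hQ a; positivity
  have hu' : 1 / (1 + c) * ((1 - e) • P + e • S) a + c / (1 + c) * ((1 - e) • Q + e • S) a =
      (1 - e) * u + e * S a := by
    simp only [Pi.add_apply, Pi.smul_apply, smul_eq_mul, hu]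
    field_simp
    ring
  have key : ∀ r : ℝ, 0 ≤ r → (u = 0 → r = 0) →
      ((1 - e) * r + e * S a) * Real.logb 2 (((1 - e) * r + e * S a) / ((1 - e) * u + e * S a)) ≤
        (1 - e) * (r * Real.logb 2 (r / u)) := by
    intro r hr hru
    have := add_mul_log_div_le (mul_nonneg he.le hr) (mul_nonneg he.le hu0)
      (mul_nonneg he0 (hS a)) (fun h => by
        rw [hru ((mul_eq_zero.1 h).resolve_left he.ne'), mul_zero])
    rw [mul_div_mul_left _ _ he.ne'] at this
    rw [Real.logb, Real.logb, ← mul_div_assoc, ← mul_div_assoc, ← mul_div_assoc, ← mul_assoc]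
    exact div_le_div_of_nonneg_right this (Real.log_pos one_lt_two).le
  rw [hu']
  simp only [Pi.add_apply, Pi.smul_apply, smul_eq_mul]
  have k1 := key (P a) (hP a) fun h => (mixture_eq_zero hc (hP a) (hQ a) h).1
  have k2 := key (Q a) (hQ a) fun h => (mixture_eq_zero hc (hP a) (hQ a) h).2
  have k3 := mul_le_mul_of_nonneg_left k2 hc.le
  linarith

/-- `n D(P_y‖P)` is the sum over positions of the log-ratios of the two letter probabilities. -/
theorem seqProb_eq_rpow (hn : 0 < n) {P : ι → ℝ} (hP : ∀ a, 0 ≤ P a) (y : Fin n → ι)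
    (h : ∀ a, P a = 0 → seqType y a = 0) :
    seqProb P y = 2 ^ (-(n * klReal (seqType y) P)) * seqProb (seqType y) y := by
  have hpos : ∀ i, 0 < P (y i) := fun i =>
    (hP _).lt_of_ne fun h0 => (seqType_apply_pos y i).ne' (h _ h0.symm)
  have hn' : (n : ℝ) ≠ 0 := by positivity
  rw [klReal, sum_seqType_mul y fun a => Real.logb 2 (seqType y a / P a), mul_div_cancel₀ _ hn',
    ← Finset.sum_neg_distrib, Real.rpow_sum_of_pos two_pos, seqProb, seqProb,
    ← Finset.prod_mul_distrib]
  refine Finset.prod_congr rfl fun i _ => ?_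
  have h1 := hpos i
  have h2 := seqType_apply_pos y i
  rw [Real.rpow_neg two_pos.le, Real.rpow_logb two_pos (by norm_num) (by positivity)]
  field_simp

theorem seqProb_eq_zero {P : ι → ℝ} {y : Fin n → ι} (h : ¬ ∀ a, P a = 0 → seqType y a = 0) :
    seqProb P y = 0 := by
  push Not at h
  obtain ⟨a, h1, h2⟩ := h
  obtain ⟨i, rfl⟩ := exists_of_seqType_ne_zero h2
  exact Finset.prod_eq_zero (Finset.mem_univ i) h1

end Divergence

/-! ### Exponential bounds, and optimality of the acceptance region. -/

section Exponents

variable {ι : Type*} [Fintype ι] [DecidableEq ι] {n N : ℕ}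

theorem exists_seqType_tendsto {W : ι → ℝ} (hW : W ∈ stdSimplex ℝ ι) (e : ι) {m : ℕ → ℕ}
    (hm0 : ∀ k, 0 < m k) (hm : Tendsto m atTop atTop) :
    ∃ w : ∀ k, Fin (m k) → ι, (∀ k a, a ≠ e → seqType (w k) a ≤ W a) ∧
      Tendsto (fun k => seqType (w k)) atTop (𝓝 W) := by
  choose w hw1 hw2 using fun k => exists_seqType_near hW e (hm0 k)
  refine ⟨w, hw1, tendsto_pi_nhds.2 fun a => ?_⟩
  rw [tendsto_iff_dist_tendsto_zero]
  refine squeeze_zero (fun _ => dist_nonneg) (fun k => hw2 k a) ?_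
  exact Tendsto.const_div_atTop (tendsto_natCast_atTop_atTop.comp hm) _

theorem threshold_le {lam c : ℝ} (hc : 0 < c) (n : ℕ) : threshold ι lam c n ≤ lam := by
  rw [threshold]
  have h1 : 0 ≤ Real.logb 2 (((n : ℝ) + 1) * (c * n + 1)) :=
    Real.logb_nonneg one_lt_two (one_le_mul_of_one_le_of_one_le
      (by have : (0 : ℝ) ≤ n := n.cast_nonneg
          linarith) (by have : 0 ≤ c * n := by positivity
                        linarith))
  have : 0 ≤ Fintype.card ι * (Real.logb 2 (((n : ℝ) + 1) * (c * n + 1)) / n) := by positivity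
  linarith

theorem tendsto_logb_mul_add_one_div {c : ℝ} (hc : 0 < c) :
    Tendsto (fun n : ℕ => Real.logb 2 (c * n + 1) / n) atTop (𝓝 0) := by
  have h1 : Tendsto (fun x : ℝ => Real.log x / x) atTop (𝓝 0) := by
    simpa using Real.isLittleO_log_id_atTop.tendsto_div_nhds_zero
  have h2 : Tendsto (fun n : ℕ => c * (n : ℝ) + 1) atTop atTop :=
    tendsto_atTop_add_const_right _ _ (tendsto_natCast_atTop_atTop.const_mul_atTop hc)
  have h3 : Tendsto (fun n : ℕ => (c * (n : ℝ) + 1) / n) atTop (𝓝 c) := by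
    have : Tendsto (fun n : ℕ => c + 1 / (n : ℝ)) atTop (𝓝 (c + 0)) :=
      tendsto_const_nhds.add tendsto_one_div_atTop_nhds_zero_nat
    rw [add_zero] at this
    refine this.congr' ?_
    filter_upwards [eventually_gt_atTop 0] with n hn
    have : (n : ℝ) ≠ 0 := by positivity
    field_simp
  have h4 := ((h1.comp h2).mul h3).div_const (Real.log 2)
  simp only [zero_mul, zero_div] at h4
  refine h4.congr' ?_
  filter_upwards [eventually_gt_atTop 0] with n hn
  have : c * (n : ℝ) + 1 ≠ 0 := by positivity
  simp only [Function.comp, Real.logb]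
  field_simp

theorem tendsto_threshold {lam c : ℝ} (hc : 0 < c) :
    Tendsto (fun n => threshold ι lam c n) atTop (𝓝 lam) := by
  have h1 := (tendsto_logb_mul_add_one_div one_pos).add (tendsto_logb_mul_add_one_div hc)
  have h2 := (h1.const_mul (Fintype.card ι : ℝ)).const_sub lam
  simp only [add_zero, mul_zero, sub_zero] at h2
  refine h2.congr fun n => ?_
  have e1 : (1 : ℝ) * n + 1 ≠ 0 := by positivity
  have e2 : c * (n : ℝ) + 1 ≠ 0 := by positivity
  rw [threshold, ← add_div, ← Real.logb_mul e1 e2, one_mul]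

/-- The bound on the number of pairs of types, as an exponential. -/
theorem card_types_eq_rpow {lam c : ℝ} (hc : 0 < c) (hn : 0 < n) (hN : (N : ℝ) = c * n) :
    ((n : ℝ) + 1) ^ Fintype.card ι * ((N : ℝ) + 1) ^ Fintype.card ι =
      2 ^ (n * (lam - threshold ι lam c n)) := by
  have hn' : (n : ℝ) ≠ 0 := by positivity
  have h : n * (lam - threshold ι lam c n) =
      Real.logb 2 (((n : ℝ) + 1) * (c * n + 1)) * (Fintype.card ι : ℕ) := by
    rw [threshold]; field_simp; ring
  rw [h, Real.rpow_mul two_pos.le, Real.rpow_logb two_pos (by norm_num) (by positivity),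
    Real.rpow_natCast, mul_pow, hN]

theorem sum_sum_le_mul_card_types (hn : 0 < n) (hN : 0 < N)
    {g : (Fin n → ι) → (Fin N → ι) → ℝ} {B : ℝ} (hB : 0 ≤ B)
    (hg : ∀ y t, g y t ≤ B * (seqProb (seqType y) y * seqProb (seqType t) t)) :
    ∑ y, ∑ t, g y t ≤ B * (((n : ℝ) + 1) ^ Fintype.card ι * ((N : ℝ) + 1) ^ Fintype.card ι) := by
  calc ∑ y, ∑ t, g y t ≤
        ∑ y : Fin n → ι, ∑ t : Fin N → ι, B * (seqProb (seqType y) y * seqProb (seqType t) t) :=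
        Finset.sum_le_sum fun y _ => Finset.sum_le_sum fun t _ => hg y t
    _ = B * ((∑ y : Fin n → ι, seqProb (seqType y) y) *
          ∑ t : Fin N → ι, seqProb (seqType t) t) := by
        rw [Finset.sum_mul_sum]; simp only [Finset.mul_sum]
    _ ≤ _ := by
        refine mul_le_mul_of_nonneg_left ?_ hB
        exact mul_le_mul (sum_seqProb_seqType_le hn) (sum_seqProb_seqType_le hN)
          (Finset.sum_nonneg fun t _ => (seqProb_seqType_pos t).le) (by positivity)

/-- One pair of type classes carries, under its own types, at least the reciprocal of the number of
pairs of types. -/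
theorem le_card_types_mul_sum_sum (hn : 0 < n) (hN : 0 < N)
    {g : (Fin n → ι) → (Fin N → ι) → ℝ} {B : ℝ} (hB : 0 ≤ B) (hg0 : ∀ y t, 0 ≤ g y t)
    (y₀ : Fin n → ι) (t₀ : Fin N → ι)
    (hg : ∀ y t, letterCount y = letterCount y₀ → letterCount t = letterCount t₀ →
      B * (seqProb (seqType y) y * seqProb (seqType t) t) ≤ g y t) :
    B ≤ (((n : ℝ) + 1) ^ Fintype.card ι * ((N : ℝ) + 1) ^ Fintype.card ι) * ∑ y, ∑ t, g y t := by
  set Y := ∑ y : Fin n → ι with letterCount y = letterCount y₀, seqProb (seqType y₀) y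
  set T := ∑ t : Fin N → ι with letterCount t = letterCount t₀, seqProb (seqType t₀) t
  have hYT : B * (Y * T) ≤ ∑ y, ∑ t, g y t := by
    calc B * (Y * T) = ∑ y : Fin n → ι with letterCount y = letterCount y₀,
          ∑ t : Fin N → ι with letterCount t = letterCount t₀,
            B * (seqProb (seqType y₀) y * seqProb (seqType t₀) t) := by
          rw [Finset.sum_mul_sum]; simp only [Finset.mul_sum]
      _ ≤ ∑ y : Fin n → ι with letterCount y = letterCount y₀,
          ∑ t : Fin N → ι with letterCount t = letterCount t₀, g y t := by
          refine Finset.sum_le_sum fun y hy => Finset.sum_le_sum fun t ht => ?_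
          have h1 := (Finset.mem_filter.1 hy).2
          have h2 := (Finset.mem_filter.1 ht).2
          rw [← seqType_eq_iff.2 h1, ← seqType_eq_iff.2 h2]
          exact hg y t h1 h2
      _ ≤ ∑ y : Fin n → ι with letterCount y = letterCount y₀, ∑ t, g y t :=
          Finset.sum_le_sum fun y _ => Finset.sum_le_univ_sum_of_nonneg fun t => hg0 y t
      _ ≤ _ := Finset.sum_le_univ_sum_of_nonneg fun y => Finset.sum_nonneg fun t _ => hg0 y t
  have hY : 1 ≤ ((n : ℝ) + 1) ^ Fintype.card ι * Y := one_le_mul_sum_typeClass hn y₀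
  have hT : 1 ≤ ((N : ℝ) + 1) ^ Fintype.card ι * T := one_le_mul_sum_typeClass hN t₀
  set a := ((n : ℝ) + 1) ^ Fintype.card ι
  set b := ((N : ℝ) + 1) ^ Fintype.card ι
  calc B ≤ B * ((a * Y) * (b * T)) := le_mul_of_one_le_right hB (one_le_mul_of_one_le_of_one_le hY hT)
    _ = (a * b) * (B * (Y * T)) := by ring
    _ ≤ _ := mul_le_mul_of_nonneg_left hYT (by positivity)

theorem seqProb_mul_seqProb {c : ℝ} (hn : 0 < n) (hN0 : 0 < N) (hN : (N : ℝ) = c * n) {P Q : ι → ℝ}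
    (hP : ∀ a, 0 ≤ P a) (hQ : ∀ a, 0 ≤ Q a) (y : Fin n → ι) (t : Fin N → ι)
    (hy : ∀ a, P a = 0 → seqType y a = 0) (ht : ∀ a, Q a = 0 → seqType t a = 0) :
    seqProb P y * seqProb Q t = 2 ^ (-(n * (klReal (seqType y) P + c * klReal (seqType t) Q))) *
      (seqProb (seqType y) y * seqProb (seqType t) t) := by
  rw [seqProb_eq_rpow hn hP y hy, seqProb_eq_rpow hN0 hQ t ht, hN]
  have : -(n * (klReal (seqType y) P + c * klReal (seqType t) Q)) =
      -(n * klReal (seqType y) P) + -(c * n * klReal (seqType t) Q) := by ring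
  rw [this, Real.rpow_add two_pos]
  ring

theorem mem_optRegion_iff {lam c : ℝ} (hc : 0 < c) {P Q : ι → ℝ} (hP : ∀ a, 0 ≤ P a)
    (hQ : ∀ a, 0 ≤ Q a) :
    (P, Q) ∈ (optRegion lam c n : Region ι) ↔ glrReal c P Q < threshold ι lam c n := by
  simp only [optRegion, Set.mem_ofPred_eq, glr_eq_coe hc hP hQ, EReal.coe_lt_coe_iff]

/-- The gap `lam - threshold` is lost twice: once because rejection starts at the threshold, once in
the union over types. -/
theorem falsePos_optRegion_le {lam c : ℝ} (hc : 0 < c) (hn : 0 < n) (hN : (N : ℝ) = c * n) :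
    (optRegion lam c n : Region ι) ∈
      defenderStrategies (lam - 2 * (lam - threshold ι lam c n)) n N := by
  have hN0 : 0 < N := by
    have : (0 : ℝ) < N := by rw [hN]; positivity
    exact_mod_cast this
  intro P hP
  rw [falsePos]
  refine (sum_sum_le_mul_card_types (B := 2 ^ (-(n * threshold ι lam c n))) hn hN0
    (by positivity) fun x t => ?_).trans_eq ?_
  · have hx := seqType_mem_stdSimplex hn x
    have ht := seqType_mem_stdSimplex hN0 t
    have hpos : 0 ≤ seqProb (seqType x) x * seqProb (seqType t) t :=
      mul_nonneg (seqProb_seqType_pos x).le (seqProb_seqType_pos t).le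
    have hR : (0 : ℝ) ≤ 2 ^ (-(n * threshold ι lam c n)) *
      (seqProb (seqType x) x * seqProb (seqType t) t) := mul_nonneg (by positivity) hpos
    split_ifs with h
    · exact hR
    by_cases h1 : ∀ a, P a = 0 → seqType x a = 0
    · by_cases h2 : ∀ a, P a = 0 → seqType t a = 0
      · rw [seqProb_mul_seqProb hn hN0 hN hP.1 hP.1 x t h1 h2]
        rw [mem_optRegion_iff hc hx.1 ht.1, not_lt] at h
        refine mul_le_mul_of_nonneg_right ?_ hpos
        refine Real.rpow_le_rpow_of_exponent_le one_le_two (neg_le_neg ?_)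
        exact mul_le_mul_of_nonneg_left (h.trans (glrReal_le_klReal hc hx ht hP h1 h2))
          (by positivity)
      · rw [seqProb_eq_zero h2, mul_zero]; exact hR
    · rw [seqProb_eq_zero h1, zero_mul]; exact hR
  · rw [card_types_eq_rpow (lam := lam) hc hn hN, ← Real.rpow_add two_pos]
    congr 1
    ring

/-- Every strategy of the defender accepts the pairs of types accepted by the optimal region. -/
theorem mem_of_mem_optRegion {lam c : ℝ} (hc : 0 < c) (hn : 0 < n) (hN : (N : ℝ) = c * n)
    {Λ : Region ι} (hΛ : Λ ∈ defenderStrategies lam n N) (x : Fin n → ι) (t : Fin N → ι)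
    (h : (seqType x, seqType t) ∈ (optRegion lam c n : Region ι)) :
    (seqType x, seqType t) ∈ Λ := by
  have hN0 : 0 < N := by
    have : (0 : ℝ) < N := by rw [hN]; positivity
    exact_mod_cast this
  by_contra hnot
  have hx := seqType_mem_stdSimplex hn x
  have ht := seqType_mem_stdSimplex hN0 t
  rw [mem_optRegion_iff hc hx.1 ht.1] at h
  have hU := mixture_mem_stdSimplex hc hx ht
  -- The false positive constraint is tested at the mixture, where the exponent of the rejected
  -- class equals `h_c`, below the threshold.
  have hfp := hΛ _ hU
  set U : ι → ℝ := fun a => 1 / (1 + c) * seqType x a + c / (1 + c) * seqType t a with hUdef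
  have hlow : (2 : ℝ) ^ (-(n * glrReal c (seqType x) (seqType t))) ≤
      (((n : ℝ) + 1) ^ Fintype.card ι * ((N : ℝ) + 1) ^ Fintype.card ι) * falsePos n N U Λ := by
    rw [falsePos]
    refine le_card_types_mul_sum_sum hn hN0 (by positivity) (fun y s => ?_) x t fun y s hy hs => ?_
    · split_ifs
      · exact le_rfl
      · exact mul_nonneg (seqProb_nonneg hU.1 y) (seqProb_nonneg hU.1 s)
    · have ey := seqType_eq_iff.2 hy
      have es := seqType_eq_iff.2 hs
      rw [if_neg (by rwa [ey, es]), seqProb_mul_seqProb hn hN0 hN hU.1 hU.1 y s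
        (fun a h => by rw [ey]; exact (mixture_eq_zero hc (hx.1 a) (ht.1 a) h).1)
        (fun a h => by rw [es]; exact (mixture_eq_zero hc (hx.1 a) (ht.1 a) h).2),
        glrReal_eq_klReal hc hx.1 ht.1, ey, es]
  rw [card_types_eq_rpow (lam := lam) hc hn hN] at hlow
  have hup := hlow.trans (mul_le_mul_of_nonneg_left hfp (by positivity))
  rw [← Real.rpow_add two_pos, Real.rpow_le_rpow_left_iff one_lt_two] at hup
  have hn' : (0 : ℝ) < n := by positivity
  nlinarith

end Exponents

/-! ### Equilibrium, and attacks as transports between pmfs. -/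

section Game

variable {𝒳 : Type*} [Fintype 𝒳] [DecidableEq 𝒳] {n N : ℕ}

theorem falseNeg_mono {PX PY : 𝒳 → ℝ} (hPX : ∀ a, 0 ≤ PX a) (hPY : ∀ a, 0 ≤ PY a)
    {Λ Λ' : Region 𝒳} {f g : Attack 𝒳 n N}
    (h : ∀ y t, (seqType (f y t), seqType t) ∈ Λ → (seqType (g y t), seqType t) ∈ Λ') :
    falseNeg PX PY Λ f ≤ falseNeg PX PY Λ' g := by
  rw [falseNeg, falseNeg]
  refine Finset.sum_le_sum fun t _ => Finset.sum_le_sum fun y _ => ?_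
  split_ifs with h1 h2 h2
  · exact le_rfl
  · exact absurd (h y t h1) h2
  · exact mul_nonneg (seqProb_nonneg hPY y) (seqProb_nonneg hPX t)
  · exact le_rfl

theorem isAsymptoticEquilibrium_optRegion (ρ : 𝒳 → 𝒳 → ℝ) (D lam c : ℝ) (hc : 0 < c)
    (PX PY : 𝒳 → ℝ) (hPX : ∀ a, 0 ≤ PX a) (hPY : ∀ a, 0 ≤ PY a)
    (n N : ℕ → ℕ) (hn0 : ∀ k, 0 < n k) (hn : Tendsto n atTop atTop)
    (hN : ∀ k, (N k : ℝ) = c * n k)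
    (f : ∀ k, Attack 𝒳 (n k) (N k)) (hf : ∀ k, IsOptAttack ρ D c (f k)) :
    IsAsymptoticEquilibrium ρ D lam PX PY n N (fun k => optRegion lam c (n k)) f := by
  refine ⟨⟨fun k => 2 * (lam - threshold 𝒳 lam c (n k)), ?_, fun k =>
    falsePos_optRegion_le hc (hn0 k) (hN k)⟩, fun k Λ' hΛ' g _ => ?_, fun k => ⟨fun y t =>
    (hf k y t).1, fun g hg => ?_⟩⟩
  · have := (((tendsto_threshold (ι := 𝒳) (lam := lam) hc).comp hn).const_sub lam).const_mul 2
    simpa using this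
  · exact falseNeg_mono hPX hPY fun y t h => mem_of_mem_optRegion hc (hn0 k) (hN k) hΛ' _ _ h
  · exact falseNeg_mono hPX hPY fun y t h => ((hf k y t).2 _ (hg y t)).trans_lt h

/-- First marginal of a joint pmf. -/
def fstMarginal (W : 𝒳 × 𝒳 → ℝ) : 𝒳 → ℝ := fun a => ∑ b, W (a, b)

/-- Second marginal of a joint pmf. -/
def sndMarginal (W : 𝒳 × 𝒳 → ℝ) : 𝒳 → ℝ := fun b => ∑ a, W (a, b)

theorem continuous_fstMarginal : Continuous (fstMarginal : (𝒳 × 𝒳 → ℝ) → 𝒳 → ℝ) := by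
  unfold fstMarginal; fun_prop

theorem continuous_sndMarginal : Continuous (sndMarginal : (𝒳 × 𝒳 → ℝ) → 𝒳 → ℝ) := by
  unfold sndMarginal; fun_prop

theorem fstMarginal_mem_stdSimplex {W : 𝒳 × 𝒳 → ℝ} (hW : W ∈ stdSimplex ℝ (𝒳 × 𝒳)) :
    fstMarginal W ∈ stdSimplex ℝ 𝒳 :=
  ⟨fun _ => Finset.sum_nonneg fun _ _ => hW.1 _, by
    rw [← hW.2, Fintype.sum_prod_type]; rfl⟩

theorem sndMarginal_mem_stdSimplex {W : 𝒳 × 𝒳 → ℝ} (hW : W ∈ stdSimplex ℝ (𝒳 × 𝒳)) :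
    sndMarginal W ∈ stdSimplex ℝ 𝒳 :=
  ⟨fun _ => Finset.sum_nonneg fun _ _ => hW.1 _, by
    rw [← hW.2, Fintype.sum_prod_type_right]; rfl⟩

theorem seqType_comp_apply {ι : Type*} [Fintype ι] [DecidableEq ι] (w : Fin n → ι) (p : ι → 𝒳)
    (a : 𝒳) : seqType (fun i => p (w i)) a = ∑ e, seqType w e * if p e = a then 1 else 0 := by
  rw [sum_seqType_mul w fun e => if p e = a then (1 : ℝ) else 0, seqType]
  simp

theorem fstMarginal_seqType (w : Fin n → 𝒳 × 𝒳) :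
    fstMarginal (seqType w) = seqType fun i => (w i).1 := by
  funext a
  rw [seqType_comp_apply w Prod.fst a, Fintype.sum_prod_type_right, fstMarginal]
  simp

theorem sndMarginal_seqType (w : Fin n → 𝒳 × 𝒳) :
    sndMarginal (seqType w) = seqType fun i => (w i).2 := by
  funext a
  rw [seqType_comp_apply w Prod.snd a, Fintype.sum_prod_type, sndMarginal]
  simp

theorem distortion_eq_sum_seqType (hn : 0 < n) (ρ : 𝒳 → 𝒳 → ℝ) (w : Fin n → 𝒳 × 𝒳) :
    distortion ρ (fun i => (w i).1) (fun i => (w i).2) =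
      n * ∑ e, seqType w e * ρ e.1 e.2 := by
  have hn' : (n : ℝ) ≠ 0 := by positivity
  rw [sum_seqType_mul w fun e => ρ e.1 e.2, mul_div_cancel₀ _ hn', distortion]

/-- Permuting `y` and `z` together changes neither the types nor the additive distortion, so one
good pair serves the whole type class. -/
theorem mem_gammaN_of_seq {ρ : 𝒳 → 𝒳 → ℝ} {D lam c : ℝ} {Q : 𝒳 → ℝ} {y z : Fin n → 𝒳}
    (hz : (seqType z, Q) ∈ (optRegion lam c n : Region 𝒳)) (hd : distortion ρ y z ≤ n * D) :
    seqType y ∈ gammaN ρ D lam c n Q := by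
  refine ⟨⟨y, rfl⟩, fun y' hy' => ?_⟩
  obtain ⟨σ, rfl⟩ := exists_perm_of_seqType_eq hy'
  refine ⟨z ∘ σ, by rwa [seqType_comp_perm], ?_⟩
  exact (Equiv.sum_comp σ fun i => ρ (y i) (z i)).trans_le hd

theorem mem_optRegion_attack_iff {ρ : 𝒳 → 𝒳 → ℝ} {D lam c : ℝ} {f : Attack 𝒳 n N}
    (hf : IsOptAttack ρ D c f) (y : Fin n → 𝒳) (t : Fin N → 𝒳) :
    (seqType (f y t), seqType t) ∈ (optRegion lam c n : Region 𝒳) ↔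
      seqType y ∈ gammaN ρ D lam c n (seqType t) := by
  refine ⟨fun h => mem_gammaN_of_seq h (hf y t).1, fun h => ?_⟩
  obtain ⟨z, hz, hd⟩ := h.2 y rfl
  exact ((hf y t).2 z hd).trans_lt hz

/-- Joint pmfs that move their first marginal, at an expected cost at most `D`, to a pmf that is
not separated from `Q`. -/
def transports (ρ : 𝒳 → 𝒳 → ℝ) (D lam c : ℝ) (Q : 𝒳 → ℝ) : Set (𝒳 × 𝒳 → ℝ) :=
  {W | W ∈ stdSimplex ℝ (𝒳 × 𝒳) ∧ ∑ e, W e * ρ e.1 e.2 ≤ D ∧ glrReal c (sndMarginal W) Q ≤ lam}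

theorem isCompact_transports (ρ : 𝒳 → 𝒳 → ℝ) (D lam c : ℝ) (Q : 𝒳 → ℝ) :
    IsCompact (transports ρ D lam c Q) := by
  have h1 : Continuous fun W : 𝒳 × 𝒳 → ℝ => ∑ e, W e * ρ e.1 e.2 := by fun_prop
  have h2 : Continuous fun W : 𝒳 × 𝒳 → ℝ => glrReal c (sndMarginal W) Q :=
    (continuous_glrReal c).comp (continuous_sndMarginal.prodMk continuous_const)
  exact (isCompact_stdSimplex ℝ (𝒳 × 𝒳)).inter_right
    ((isClosed_le h1 continuous_const).inter (isClosed_le h2 continuous_const))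

theorem gammaN_subset {ρ : 𝒳 → 𝒳 → ℝ} {D lam c : ℝ} (hc : 0 < c) (hn : 0 < n) {Q : 𝒳 → ℝ}
    (hQ : ∀ a, 0 ≤ Q a) :
    gammaN ρ D lam c n Q ⊆ fstMarginal '' transports ρ D lam c Q := by
  rintro _ ⟨⟨y, rfl⟩, h⟩
  obtain ⟨z, hz, hd⟩ := h y rfl
  refine ⟨seqType fun i => (y i, z i), ⟨seqType_mem_stdSimplex hn _, ?_, ?_⟩,
    fstMarginal_seqType _⟩
  · have h1 := distortion_eq_sum_seqType hn ρ fun i => (y i, z i)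
    have hn' : (0 : ℝ) < n := by positivity
    exact le_of_mul_le_mul_left (h1 ▸ hd) hn'
  · rw [mem_optRegion_iff hc (seqType_nonneg z) hQ] at hz
    rw [sndMarginal_seqType]
    exact hz.le.trans (threshold_le hc n)

/-- Types that converge to a strictly feasible transport are eventually feasible, when they
exceed it only at a point of the diagonal. -/
theorem eventually_mem_gammaN {ρ : 𝒳 → 𝒳 → ℝ} (hρ : ∀ a b, 0 ≤ ρ a b) (hρ0 : ∀ a, ρ a a = 0)
    {D lam c : ℝ} (hc : 0 < c) {Q : 𝒳 → ℝ} {W : 𝒳 × 𝒳 → ℝ}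
    (hWD : ∑ e, W e * ρ e.1 e.2 ≤ D) (hWlam : glrReal c (sndMarginal W) Q < lam)
    (a : 𝒳) {m : ℕ → ℕ} (hm0 : ∀ k, 0 < m k) (hm : Tendsto m atTop atTop)
    {q : ℕ → 𝒳 → ℝ} (hq0 : ∀ k b, 0 ≤ q k b) (hq : Tendsto q atTop (𝓝 Q))
    (w : ∀ k, Fin (m k) → 𝒳 × 𝒳) (hwle : ∀ k e, e ≠ (a, a) → seqType (w k) e ≤ W e)
    (hw : Tendsto (fun k => seqType (w k)) atTop (𝓝 W)) :
    ∀ᶠ k in atTop, seqType (fun i => (w k i).1) ∈ gammaN ρ D lam c (m k) (q k) := by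
  have h1 : Tendsto (fun k => glrReal c (sndMarginal (seqType (w k))) (q k)) atTop
      (𝓝 (glrReal c (sndMarginal W) Q)) := 
    tendsto_glrReal c ((continuous_sndMarginal.tendsto W).comp hw) hq
  have h2 := (tendsto_threshold (ι := 𝒳) (lam := lam) hc).comp hm
  filter_upwards [h1.eventually_lt h2 hWlam] with k hk
  refine mem_gammaN_of_seq (z := fun i => (w k i).2) ?_ ?_
  · rw [mem_optRegion_iff hc (seqType_nonneg _) (hq0 k), ← sndMarginal_seqType]
    exact hk
  · rw [distortion_eq_sum_seqType (hm0 k)]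
    refine mul_le_mul_of_nonneg_left (le_trans (Finset.sum_le_sum fun e _ => ?_) hWD)
      (by positivity)
    -- The only entry that rounding may increase is diagonal, hence free.
    by_cases he : e = (a, a)
    · simp [he, hρ0]
    · exact mul_le_mul_of_nonneg_right (hwle k e he) (hρ _ _)

/-- The joint pmf of two equal letters with pmf `S`. -/
def diagonalCoupling (S : 𝒳 → ℝ) : 𝒳 × 𝒳 → ℝ := fun e => if e.1 = e.2 then S e.1 else 0

theorem fstMarginal_diagonalCoupling (S : 𝒳 → ℝ) : fstMarginal (diagonalCoupling S) = S := by
  funext a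
  simp [fstMarginal, diagonalCoupling]

theorem sndMarginal_diagonalCoupling (S : 𝒳 → ℝ) : sndMarginal (diagonalCoupling S) = S := by
  funext a
  simp [sndMarginal, diagonalCoupling]

theorem diagonalCoupling_mem_stdSimplex {S : 𝒳 → ℝ} (hS : S ∈ stdSimplex ℝ 𝒳) :
    diagonalCoupling S ∈ stdSimplex ℝ (𝒳 × 𝒳) := by
  refine ⟨fun e => ?_, ?_⟩
  · rw [diagonalCoupling]
    split_ifs
    exacts [hS.1 _, le_rfl]
  · rw [← hS.2, Fintype.sum_prod_type]
    simp [diagonalCoupling]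

theorem cost_diagonalCoupling {ρ : 𝒳 → 𝒳 → ℝ} (hρ0 : ∀ a, ρ a a = 0) (S : 𝒳 → ℝ) :
    ∑ e, diagonalCoupling S e * ρ e.1 e.2 = 0 := by
  refine Finset.sum_eq_zero fun e _ => ?_
  rw [diagonalCoupling]
  split_ifs with h
  · rw [h, hρ0, mul_zero]
  · rw [zero_mul]

theorem fstMarginal_mix (W V : 𝒳 × 𝒳 → ℝ) (s : ℝ) :
    fstMarginal ((1 - s) • W + s • V) = (1 - s) • fstMarginal W + s • fstMarginal V := by
  funext b
  simp only [fstMarginal, Pi.add_apply, Pi.smul_apply, smul_eq_mul, Finset.sum_add_distrib,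
    ← Finset.mul_sum]

theorem sndMarginal_mix (W V : 𝒳 × 𝒳 → ℝ) (s : ℝ) :
    sndMarginal ((1 - s) • W + s • V) = (1 - s) • sndMarginal W + s • sndMarginal V := by
  funext b
  simp only [sndMarginal, Pi.add_apply, Pi.smul_apply, smul_eq_mul, Finset.sum_add_distrib,
    ← Finset.mul_sum]

theorem mix_mem_stdSimplex {ι : Type*} [Fintype ι] {W V : ι → ℝ}
    (hW : W ∈ stdSimplex ℝ ι) (hV : V ∈ stdSimplex ℝ ι) {s : ℝ} (hs0 : 0 ≤ s) (hs1 : s ≤ 1) :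
    (1 - s) • W + s • V ∈ stdSimplex ℝ ι :=
  convex_stdSimplex ℝ ι hW hV (by linarith) hs0 (by ring)

theorem cost_mix_diagonalCoupling_le {ρ : 𝒳 → 𝒳 → ℝ} (hρ0 : ∀ a, ρ a a = 0) {D : ℝ} (hD : 0 ≤ D)
    {W : 𝒳 × 𝒳 → ℝ} (hWD : ∑ e, W e * ρ e.1 e.2 ≤ D) (S : 𝒳 → ℝ) {s : ℝ} (hs0 : 0 ≤ s)
    (hs1 : s ≤ 1) :
    ∑ e, ((1 - s) • W + s • diagonalCoupling S) e * ρ e.1 e.2 ≤ D := by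
  simp only [Pi.add_apply, Pi.smul_apply, smul_eq_mul, add_mul, mul_assoc,
    Finset.sum_add_distrib, ← Finset.mul_sum, cost_diagonalCoupling hρ0 S]
  nlinarith

/-- Mixing `Q` with the same `S` gives the bound `(1 - s) lam < lam`; this slack pays for the
finite-length threshold. -/
theorem glrReal_mix_diagonalCoupling_lt {lam c : ℝ} (hlam : 0 < lam) (hc : 0 < c)
    {W : 𝒳 × 𝒳 → ℝ} (hW : W ∈ stdSimplex ℝ (𝒳 × 𝒳)) {Q S : 𝒳 → ℝ} (hQ : Q ∈ stdSimplex ℝ 𝒳)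
    (hS : S ∈ stdSimplex ℝ 𝒳) (h : glrReal c (sndMarginal W) Q ≤ lam) {s : ℝ} (hs0 : 0 < s)
    (hs1 : s < 1) :
    glrReal c (sndMarginal ((1 - s) • W + s • diagonalCoupling S)) ((1 - s) • Q + s • S) < lam := by
  rw [sndMarginal_mix, sndMarginal_diagonalCoupling]
  have := glrReal_mix_le hc (sndMarginal_mem_stdSimplex hW).1 hQ.1 hS.1 hs0.le hs1
  nlinarith

theorem tendsto_mix {E : Type*} [TopologicalSpace E] [AddCommGroup E] [Module ℝ E]
    [ContinuousAdd E] [ContinuousSMul ℝ E] (x z : E) :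
    Tendsto (fun s : ℝ => (1 - s) • x + s • z) (𝓝[>] 0) (𝓝 x) := by
  have : Continuous fun s : ℝ => (1 - s) • x + s • z := by fun_prop
  have h := (this.tendsto 0).mono_left (nhdsWithin_le_nhds (s := Set.Ioi 0))
  simpa using h

/-- One inclusion is compactness of the image. For the other, a transport is the limit of strictly
feasible ones, each of which is a limit of joint types eventually admissible. Here `Q` is fixed, so
the diagonal mass must have pmf `Q` itself. -/
theorem gammaInf_eq {ρ : 𝒳 → 𝒳 → ℝ} (hρ : ∀ a b, 0 ≤ ρ a b) (hρ0 : ∀ a, ρ a a = 0)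
    {D lam c : ℝ} (hD : 0 ≤ D) (hlam : 0 < lam) (hc : 0 < c) {Q : 𝒳 → ℝ}
    (hQ : Q ∈ stdSimplex ℝ 𝒳) :
    gammaInf ρ D lam c Q = fstMarginal '' transports ρ D lam c Q := by
  refine Set.Subset.antisymm ?_ ?_
  · refine closure_minimal (Set.iUnion₂_subset fun n hn => gammaN_subset hc hn hQ.1) ?_
    exact ((isCompact_transports ρ D lam c Q).image continuous_fstMarginal).isClosed
  rintro _ ⟨W, ⟨hW, hWD, hWlam⟩, rfl⟩
  have hclosed : IsClosed (gammaInf ρ D lam c Q) := isClosed_closure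
  obtain ⟨a, -⟩ : ∃ a, Q a ≠ 0 := by
    by_contra! h
    have := hQ.2
    simp [h] at this
  refine hclosed.mem_of_tendsto (tendsto_mix (fstMarginal W) Q) ?_
  filter_upwards [Ioo_mem_nhdsGT (one_pos : (0 : ℝ) < 1)] with s hs
  have hV := mix_mem_stdSimplex hW (diagonalCoupling_mem_stdSimplex hQ) hs.1.le hs.2.le
  have hVD := cost_mix_diagonalCoupling_le hρ0 hD hWD Q hs.1.le hs.2.le
  have hVlam := glrReal_mix_diagonalCoupling_lt hlam hc hW hQ hQ hWlam hs.1 hs.2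
  have hQs : (1 - s) • Q + s • Q = Q := by rw [← add_smul]; simp
  have hVfst := fstMarginal_mix W (diagonalCoupling Q) s
  rw [fstMarginal_diagonalCoupling] at hVfst
  rw [hQs] at hVlam
  rw [← hVfst]
  set V := (1 - s) • W + s • diagonalCoupling Q
  obtain ⟨w, hwle, hw⟩ := exists_seqType_tendsto hV (a, a) (m := fun k => k + 1)
    (fun k => k.succ_pos) (tendsto_add_atTop_nat 1)
  have hev := eventually_mem_gammaN hρ hρ0 hc hVD hVlam a (fun k => k.succ_pos)
    (tendsto_add_atTop_nat 1) (q := fun _ => Q) (fun _ => hQ.1) tendsto_const_nhds w hwle hw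
  refine hclosed.mem_of_tendsto ((continuous_fstMarginal.tendsto V).comp hw) ?_
  filter_upwards [hev] with k hk
  refine subset_closure (Set.mem_iUnion₂.2 ⟨k + 1, Nat.succ_le_succ k.zero_le, ?_⟩)
  rw [Function.comp, fstMarginal_seqType]
  exact hk

end Game

/-! ### Both bounds on the false negative exponent, and existence of the minimizer. -/

section Exponent

variable {𝒳 : Type*} [Fintype 𝒳] [DecidableEq 𝒳] {n N : ℕ}

theorem glrReal_self {c : ℝ} (hc : 0 < c) {P : 𝒳 → ℝ} (hP : ∀ a, 0 ≤ P a) : glrReal c P P = 0 := by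
  have : (fun a => 1 / (1 + c) * P a + c / (1 + c) * P a) = P := by
    funext a
    field_simp
  rw [glrReal_eq_klReal hc hP hP, this, klReal_self]
  simp

theorem diagonalCoupling_mem_transports {ρ : 𝒳 → 𝒳 → ℝ} (hρ0 : ∀ a, ρ a a = 0) {D lam c : ℝ}
    (hD : 0 ≤ D) (hlam : 0 < lam) (hc : 0 < c) {Q : 𝒳 → ℝ} (hQ : Q ∈ stdSimplex ℝ 𝒳) :
    diagonalCoupling Q ∈ transports ρ D lam c Q :=
  ⟨diagonalCoupling_mem_stdSimplex hQ, (cost_diagonalCoupling hρ0 Q).trans_le hD, by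
    rw [sndMarginal_diagonalCoupling, glrReal_self hc hQ.1]; exact hlam.le⟩

theorem isClosed_forall_eq_zero (R : 𝒳 → ℝ) : IsClosed {P : 𝒳 → ℝ | ∀ a, R a = 0 → P a = 0} := by
  simp only [Set.ofPred_forall]
  exact isClosed_iInter fun a => isClosed_iInter fun _ =>
    isClosed_eq (continuous_apply a) continuous_const

/-- The divergence is finite exactly on a closed set and continuous there. If `K` misses that set,
the minimum is `⊤`. -/
theorem exists_isLeast_kl {K : Set (𝒳 → ℝ)} (hK : IsCompact K) (hne : K.Nonempty) (R : 𝒳 → ℝ) :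
    ∃ m, IsLeast ((fun P => kl P R) '' K) m := by
  by_cases h : (K ∩ {P | ∀ a, R a = 0 → P a = 0}).Nonempty
  · obtain ⟨P, ⟨hPK, hPR⟩, hmin⟩ := (hK.inter_right (isClosed_forall_eq_zero R)).exists_isMinOn h
      (continuous_klReal R).continuousOn
    refine ⟨kl P R, ⟨P, hPK, rfl⟩, ?_⟩
    rintro _ ⟨P', hP', rfl⟩
    by_cases h' : ∀ a, R a = 0 → P' a = 0
    · change kl P R ≤ kl P' R
      rw [kl_eq_coe hPR, kl_eq_coe h']
      exact EReal.coe_le_coe_iff.2 (hmin ⟨hP', h'⟩)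
    · exact le_top.trans_eq (kl_eq_top h').symm
  · obtain ⟨P, hP⟩ := hne
    refine ⟨⊤, ⟨P, hP, kl_eq_top fun hPR => h ⟨P, hP, hPR⟩⟩, ?_⟩
    rintro _ ⟨P', hP', rfl⟩
    exact (kl_eq_top fun hPR => h ⟨P', hP', hPR⟩).ge

/-- Only pairs with finite divergences need to be bounded by `ε`: the others have probability zero.
-/
theorem falseNeg_le {ρ : 𝒳 → 𝒳 → ℝ} {D lam c : ℝ} (hc : 0 < c) {PX PY : 𝒳 → ℝ}
    (hPX : ∀ a, 0 ≤ PX a) (hPY : ∀ a, 0 ≤ PY a) (hn : 0 < n) (hN : (N : ℝ) = c * n)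
    {f : Attack 𝒳 n N} (hf : IsOptAttack ρ D c f) {ε : ℝ}
    (hε : ∀ Q ∈ stdSimplex ℝ 𝒳, ∀ W ∈ transports ρ D lam c Q,
      (∀ a, PY a = 0 → fstMarginal W a = 0) → (∀ a, PX a = 0 → Q a = 0) →
      ε ≤ klReal (fstMarginal W) PY + c * klReal Q PX) :
    falseNeg PX PY (optRegion lam c n) f ≤ 2 ^ (-(n * ε) + n * (lam - threshold 𝒳 lam c n)) := by
  have hN0 : 0 < N := by
    have : (0 : ℝ) < N := by rw [hN]; positivity
    exact_mod_cast this
  rw [falseNeg, Finset.sum_comm]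
  refine (sum_sum_le_mul_card_types (B := 2 ^ (-(n * ε))) hn hN0
    (by positivity) fun y t => ?_).trans_eq ?_
  · have hpos : 0 ≤ seqProb (seqType y) y * seqProb (seqType t) t :=
      mul_nonneg (seqProb_seqType_pos y).le (seqProb_seqType_pos t).le
    have hR : (0 : ℝ) ≤ 2 ^ (-(n * ε)) * (seqProb (seqType y) y * seqProb (seqType t) t) :=
      mul_nonneg (by positivity) hpos
    split_ifs with h
    · by_cases h1 : ∀ a, PY a = 0 → seqType y a = 0
      · by_cases h2 : ∀ a, PX a = 0 → seqType t a = 0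
        · rw [seqProb_mul_seqProb hn hN0 hN hPY hPX y t h1 h2]
          rw [mem_optRegion_attack_iff hf] at h
          obtain ⟨W, hW, hWy⟩ := gammaN_subset hc hn (seqType_nonneg t) h
          refine mul_le_mul_of_nonneg_right ?_ hpos
          refine Real.rpow_le_rpow_of_exponent_le one_le_two (neg_le_neg ?_)
          rw [← hWy] at h1 ⊢
          exact mul_le_mul_of_nonneg_left
            (hε _ (seqType_mem_stdSimplex hN0 t) W hW h1 h2) (by positivity)
        · rw [seqProb_eq_zero h2, mul_zero]; exact hR
      · rw [seqProb_eq_zero h1, zero_mul]; exact hR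
    · exact hR
  · rw [card_types_eq_rpow (lam := lam) hc hn hN, ← Real.rpow_add two_pos]

theorem le_falseNeg {ρ : 𝒳 → 𝒳 → ℝ} {D lam c : ℝ} (hc : 0 < c) {PX PY : 𝒳 → ℝ}
    (hPX : ∀ a, 0 ≤ PX a) (hPY : ∀ a, 0 ≤ PY a) (hn : 0 < n) (hN : (N : ℝ) = c * n)
    {f : Attack 𝒳 n N} (hf : IsOptAttack ρ D c f) (y : Fin n → 𝒳) (t : Fin N → 𝒳)
    (hyt : seqType y ∈ gammaN ρ D lam c n (seqType t))
    (hy : ∀ a, PY a = 0 → seqType y a = 0) (ht : ∀ a, PX a = 0 → seqType t a = 0) :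
    (2 : ℝ) ^ (-(n * (klReal (seqType y) PY + c * klReal (seqType t) PX +
      (lam - threshold 𝒳 lam c n)))) ≤ falseNeg PX PY (optRegion lam c n) f := by
  have hN0 : 0 < N := by
    have : (0 : ℝ) < N := by rw [hN]; positivity
    exact_mod_cast this
  have key : (2 : ℝ) ^ (-(n * (klReal (seqType y) PY + c * klReal (seqType t) PX))) ≤
      (((n : ℝ) + 1) ^ Fintype.card 𝒳 * ((N : ℝ) + 1) ^ Fintype.card 𝒳) *
        falseNeg PX PY (optRegion lam c n) f := by
    rw [falseNeg, Finset.sum_comm]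
    refine le_card_types_mul_sum_sum hn hN0 (by positivity) (fun y' t' => ?_) y t
      fun y' t' hy' ht' => ?_
    · split_ifs
      · exact mul_nonneg (seqProb_nonneg hPY y') (seqProb_nonneg hPX t')
      · exact le_rfl
    · have ey := seqType_eq_iff.2 hy'
      have et := seqType_eq_iff.2 ht'
      rw [if_pos ((mem_optRegion_attack_iff hf y' t').2 (by rwa [ey, et])),
        seqProb_mul_seqProb hn hN0 hN hPY hPX y' t' (by rwa [ey]) (by rwa [et]), ey, et]
  rw [card_types_eq_rpow (lam := lam) hc hn hN] at key
  refine le_of_mul_le_mul_left (le_trans (le_of_eq ?_) key)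
    (Real.rpow_pos_of_pos two_pos (n * (lam - threshold 𝒳 lam c n)))
  rw [← Real.rpow_add two_pos]
  congr 1
  ring

/-- Achievability: the value of the objective at a feasible pair, perturbed towards a common
letter of the two sources, is eventually a lower bound for the false negative probability. -/
theorem eventually_le_falseNeg {ρ : 𝒳 → 𝒳 → ℝ} (hρ : ∀ a b, 0 ≤ ρ a b) (hρ0 : ∀ a, ρ a a = 0)
    {D lam c : ℝ} (hD : 0 ≤ D) (hlam : 0 < lam) (hc : 0 < c)
    {PX PY : 𝒳 → ℝ} (hPX : ∀ a, 0 ≤ PX a) (hPY : ∀ a, 0 ≤ PY a)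
    {a : 𝒳} (haX : 0 < PX a) (haY : 0 < PY a)
    {n N : ℕ → ℕ} (hn0 : ∀ k, 0 < n k) (hn : Tendsto n atTop atTop)
    (hN : ∀ k, (N k : ℝ) = c * n k)
    {f : ∀ k, Attack 𝒳 (n k) (N k)} (hf : ∀ k, IsOptAttack ρ D c (f k))
    {Q : 𝒳 → ℝ} (hQ : Q ∈ stdSimplex ℝ 𝒳) {W : 𝒳 × 𝒳 → ℝ} (hW : W ∈ transports ρ D lam c Q)
    (hWY : ∀ b, PY b = 0 → fstMarginal W b = 0) (hQX : ∀ b, PX b = 0 → Q b = 0)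
    {v : ℝ} (hv : klReal (fstMarginal W) PY + c * klReal Q PX < v) :
    ∀ᶠ k in atTop, (2 : ℝ) ^ (-(n k * v)) ≤ falseNeg PX PY (optRegion lam c (n k)) (f k) := by
  obtain ⟨hW0, hWD, hWlam⟩ := hW
  have hN0 : ∀ k, 0 < N k := fun k => by
    have : (0 : ℝ) < N k := by rw [hN]; have := hn0 k; positivity
    exact_mod_cast this
  have hNtop : Tendsto N atTop atTop := by
    rw [← tendsto_natCast_atTop_iff (R := ℝ)]
    simp only [hN]
    exact (tendsto_natCast_atTop_atTop.comp hn).const_mul_atTop hc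
  -- Unlike in `gammaInf_eq`, `Q` may move too. A point mass at a letter charged by both sources
  -- preserves both support conditions, and rounding excess can be put there.
  set S : 𝒳 → ℝ := Pi.single a 1 with hSdef
  have hS : S ∈ stdSimplex ℝ 𝒳 := single_mem_stdSimplex ℝ a
  have hlim : Tendsto (fun s : ℝ => klReal ((1 - s) • fstMarginal W + s • S) PY +
      c * klReal ((1 - s) • Q + s • S) PX) (𝓝[>] 0)
      (𝓝 (klReal (fstMarginal W) PY + c * klReal Q PX)) :=
    (((continuous_klReal PY).tendsto _).comp (tendsto_mix _ S)).add
      ((((continuous_klReal PX).tendsto _).comp (tendsto_mix _ S)).const_mul c)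
  obtain ⟨s, hsv, hs⟩ := ((hlim.eventually_lt_const hv).and
    (Ioo_mem_nhdsGT (one_pos : (0 : ℝ) < 1))).exists
  have hV := mix_mem_stdSimplex hW0 (diagonalCoupling_mem_stdSimplex hS) hs.1.le hs.2.le
  have hVD := cost_mix_diagonalCoupling_le hρ0 hD hWD S hs.1.le hs.2.le
  have hVlam := glrReal_mix_diagonalCoupling_lt hlam hc hW0 hQ hS hWlam hs.1 hs.2
  have hQ' := mix_mem_stdSimplex hQ hS hs.1.le hs.2.le
  have hVfst := fstMarginal_mix W (diagonalCoupling S) s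
  rw [fstMarginal_diagonalCoupling] at hVfst
  rw [← hVfst] at hsv
  have hS0 : ∀ {R : 𝒳 → ℝ}, 0 < R a → ∀ b, R b = 0 → S b = 0 := fun hR b hb =>
    Pi.single_eq_of_ne (fun h => by rw [h] at hb; exact hR.ne' hb) _
  have hVY : ∀ b, PY b = 0 → fstMarginal ((1 - s) • W + s • diagonalCoupling S) b = 0 :=
    fun b hb => by rw [hVfst]; simp [hWY b hb, hS0 haY b hb]
  have hQX' : ∀ b, PX b = 0 → ((1 - s) • Q + s • S) b = 0 :=
    fun b hb => by simp [hQX b hb, hS0 haX b hb]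
  set V := (1 - s) • W + s • diagonalCoupling S
  set Q' := (1 - s) • Q + s • S
  obtain ⟨w, hwle, hw⟩ := exists_seqType_tendsto hV (a, a) hn0 hn
  obtain ⟨t, htle, ht⟩ := exists_seqType_tendsto hQ' a hN0 hNtop
  have hev := eventually_mem_gammaN hρ hρ0 hc hVD hVlam a hn0 hn
    (fun k => seqType_nonneg (t k)) ht w hwle hw
  have hval : Tendsto (fun k => klReal (fstMarginal (seqType (w k))) PY +
      c * klReal (seqType (t k)) PX + (lam - threshold 𝒳 lam c (n k))) atTop
      (𝓝 (klReal (fstMarginal V) PY + c * klReal Q' PX + (lam - lam))) :=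
    ((((continuous_klReal PY).comp continuous_fstMarginal).tendsto V).comp hw |>.add
      ((((continuous_klReal PX).tendsto Q').comp ht).const_mul c)).add
      (((tendsto_threshold hc).comp hn).const_sub lam)
  rw [sub_self, add_zero] at hval
  filter_upwards [hev, hval.eventually_lt_const hsv] with k hk hkv
  rw [fstMarginal_seqType] at hkv
  refine le_trans ?_ (le_falseNeg hc hPX hPY (hn0 k) (hN k) (hf k) _ _ hk ?_ ?_)
  · refine Real.rpow_le_rpow_of_exponent_le one_le_two (neg_le_neg ?_)
    exact mul_le_mul_of_nonneg_left hkv.le (Nat.cast_nonneg _)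
  · intro b hb
    rw [← fstMarginal_seqType]
    -- Entries over `b ≠ a` are rounded down from zero, so the rounded type stays within the support
    -- of `PY`.
    refine Finset.sum_eq_zero fun b' _ => le_antisymm ?_ (seqType_nonneg _ _)
    refine (hwle k (b, b') fun h => ?_).trans_eq ?_
    · rw [(Prod.mk.inj h).1] at hb; exact haY.ne' hb
    · exact (Finset.sum_eq_zero_iff_of_nonneg fun _ _ => hV.1 _).1 (hVY b hb) b'
        (Finset.mem_univ b')
  · intro b hb
    refine le_antisymm ((htle k b fun h => ?_).trans_eq (hQX' b hb)) (seqType_nonneg _ _)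
    rw [h] at hb; exact haX.ne' hb

/-- Minimizing jointly over `(W, Q)` needs only compactness of one feasible set, not semicontinuity
in `Q` of the inner minimum. The common letter makes the set nonempty, hence the exponent finite. -/
theorem exists_min_exponent {ρ : 𝒳 → 𝒳 → ℝ} (hρ0 : ∀ a, ρ a a = 0) {D lam c : ℝ} (hD : 0 ≤ D)
    (hlam : 0 < lam) (hc : 0 < c) {PX PY : 𝒳 → ℝ} (hsupp : ∃ a, 0 < PX a ∧ 0 < PY a) :
    ∃ Q ∈ stdSimplex ℝ 𝒳, ∃ W ∈ transports ρ D lam c Q,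
      (∀ a, PY a = 0 → fstMarginal W a = 0) ∧ (∀ a, PX a = 0 → Q a = 0) ∧
      ∀ Q' ∈ stdSimplex ℝ 𝒳, ∀ W' ∈ transports ρ D lam c Q',
        (∀ a, PY a = 0 → fstMarginal W' a = 0) → (∀ a, PX a = 0 → Q' a = 0) →
        klReal (fstMarginal W) PY + c * klReal Q PX ≤
          klReal (fstMarginal W') PY + c * klReal Q' PX := by
  obtain ⟨a, haX, haY⟩ := hsupp
  set K : Set ((𝒳 × 𝒳 → ℝ) × (𝒳 → ℝ)) := (stdSimplex ℝ (𝒳 × 𝒳) ×ˢ stdSimplex ℝ 𝒳) ∩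
    (({p | ∑ e, p.1 e * ρ e.1 e.2 ≤ D} ∩ {p | glrReal c (sndMarginal p.1) p.2 ≤ lam}) ∩
      ({p | ∀ a, PY a = 0 → fstMarginal p.1 a = 0} ∩ {p | ∀ a, PX a = 0 → p.2 a = 0})) with hKdef
  have hKc : IsCompact K := by
    refine ((isCompact_stdSimplex ℝ (𝒳 × 𝒳)).prod (isCompact_stdSimplex ℝ 𝒳)).inter_right ?_
    have c1 : Continuous fun p : (𝒳 × 𝒳 → ℝ) × (𝒳 → ℝ) => ∑ e, p.1 e * ρ e.1 e.2 := by fun_prop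
    have c2 : Continuous fun p : (𝒳 × 𝒳 → ℝ) × (𝒳 → ℝ) => glrReal c (sndMarginal p.1) p.2 :=
      (continuous_glrReal c).comp
        ((continuous_sndMarginal.comp continuous_fst).prodMk continuous_snd)
    exact ((isClosed_le c1 continuous_const).inter (isClosed_le c2 continuous_const)).inter
      (((isClosed_forall_eq_zero PY).preimage (continuous_fstMarginal.comp continuous_fst)).inter
        ((isClosed_forall_eq_zero PX).preimage continuous_snd))
  have hS : (Pi.single a 1 : 𝒳 → ℝ) ∈ stdSimplex ℝ 𝒳 := single_mem_stdSimplex ℝ a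
  have hS0 : ∀ {R : 𝒳 → ℝ}, 0 < R a → ∀ b, R b = 0 → (Pi.single a 1 : 𝒳 → ℝ) b = 0 :=
    fun hR b hb => Pi.single_eq_of_ne (fun h => by rw [h] at hb; exact hR.ne' hb) _
  have hne : K.Nonempty := by
    obtain ⟨h1, h2, h3⟩ := diagonalCoupling_mem_transports hρ0 hD hlam hc hS
    refine ⟨(diagonalCoupling (Pi.single a 1), Pi.single a 1), ⟨h1, hS⟩, ⟨h2, h3⟩, ?_, hS0 haX⟩
    simp only [Set.mem_ofPred_eq, fstMarginal_diagonalCoupling]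
    exact hS0 haY
  have hcont : Continuous fun p : (𝒳 × 𝒳 → ℝ) × (𝒳 → ℝ) =>
      klReal (fstMarginal p.1) PY + c * klReal p.2 PX :=
    ((continuous_klReal PY).comp (continuous_fstMarginal.comp continuous_fst)).add
      (((continuous_klReal PX).comp continuous_snd).const_mul c)
  obtain ⟨⟨W, Q⟩, ⟨⟨hW, hQ⟩, ⟨hD', hl⟩, hWY, hQX⟩, hmin⟩ :=
    hKc.exists_isMinOn hne hcont.continuousOn
  exact ⟨Q, hQ, W, ⟨hW, hD', hl⟩, hWY, hQX, fun Q' hQ' W' hW' h1 h2 =>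
    hmin (show (W', Q') ∈ K from ⟨⟨hW'.1, hQ'⟩, ⟨hW'.2.1, hW'.2.2⟩, h1, h2⟩)⟩

end Exponent

end TrainedTest

/-! ### The theorem: assembling equilibrium, minimum and limit. -/

open TrainedTest
theorem theorem4 {𝒳 : Type*} [Fintype 𝒳] [DecidableEq 𝒳]
    (ρ : 𝒳 → 𝒳 → ℝ) (hρ : ∀ a b, 0 ≤ ρ a b) (hρ0 : ∀ a, ρ a a = 0)
    (D lam c : ℝ) (hD : 0 ≤ D) (hlam : 0 < lam) (hc : 0 < c)
    (PX PY : 𝒳 → ℝ) (hPX : PX ∈ stdSimplex ℝ 𝒳) (hPY : PY ∈ stdSimplex ℝ 𝒳)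
    (hsupp : ∃ a, 0 < PX a ∧ 0 < PY a)
    (n N : ℕ → ℕ) (hn0 : ∀ k, 0 < n k) (hn : Tendsto n atTop atTop)
    (hN : ∀ k, (N k : ℝ) = c * n k)
    (f : ∀ k, Attack 𝒳 (n k) (N k)) (hf : ∀ k, IsOptAttack ρ D c (f k)) :
    IsAsymptoticEquilibrium ρ D lam PX PY n N (fun k => optRegion lam c (n k)) f ∧
    ∃ (m : (𝒳 → ℝ) → EReal) (ε : ℝ),
      (∀ Q ∈ stdSimplex ℝ 𝒳,
        IsLeast ((fun P => kl P PY) '' gammaInf ρ D lam c Q) (m Q)) ∧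
      IsLeast ((fun Q => (c : EReal) * kl Q PX + m Q) '' stdSimplex ℝ 𝒳) (ε : EReal) ∧
      (∀ᶠ k in atTop, 0 < falseNeg PX PY (optRegion lam c (n k)) (f k)) ∧
      Tendsto (fun k => -Real.logb 2 (falseNeg PX PY (optRegion lam c (n k)) (f k)) / (n k : ℝ))
        atTop (𝓝 ε) ∧
      (PY ∈ gammaInf ρ D lam c PX → ε = 0) ∧
      (PY ∉ gammaInf ρ D lam c PX → 0 < ε) := by
  refine ⟨isAsymptoticEquilibrium_optRegion ρ D lam c hc PX PY hPX.1 hPY.1 n N hn0 hn hN f hf, ?_⟩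
  have hm : ∀ Q, ∃ m, Q ∈ stdSimplex ℝ 𝒳 →
      IsLeast ((fun P => kl P PY) '' gammaInf ρ D lam c Q) m := by
    intro Q
    by_cases hQ : Q ∈ stdSimplex ℝ 𝒳
    · rw [gammaInf_eq hρ hρ0 hD hlam hc hQ]
      obtain ⟨m, hm⟩ := exists_isLeast_kl
        ((isCompact_transports ρ D lam c Q).image continuous_fstMarginal)
        ⟨_, Set.mem_image_of_mem _ (diagonalCoupling_mem_transports hρ0 hD hlam hc hQ)⟩ PY
      exact ⟨m, fun _ => hm⟩
    -- The value of `m` off the simplex is irrelevant.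
    · exact ⟨0, fun h => absurd h hQ⟩
  choose m hm using hm
  obtain ⟨Q, hQ, W, hW, hWY, hQX, hmin⟩ := exists_min_exponent (ρ := ρ) hρ0 hD hlam hc hsupp
  obtain ⟨a, haX, haY⟩ := hsupp
  have hWfst := fstMarginal_mem_stdSimplex hW.1
  have hkY := klReal_nonneg hWfst hPY hWY
  have hkX := klReal_nonneg hQ hPX hQX
  -- The joint real minimum bounds the iterated extended-real one: an infinite divergence makes the
  -- right side `⊤`.
  have hlower : ∀ Q' ∈ stdSimplex ℝ 𝒳,
      ((klReal (fstMarginal W) PY + c * klReal Q PX : ℝ) : EReal) ≤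
        (c : EReal) * kl Q' PX + m Q' := by
    intro Q' hQ'
    obtain ⟨P, hP, hPm⟩ := (hm Q' hQ').1
    rw [← hPm]
    rw [gammaInf_eq hρ hρ0 hD hlam hc hQ'] at hP
    obtain ⟨W', hW', rfl⟩ := hP
    change _ ≤ (c : EReal) * kl Q' PX + kl (fstMarginal W') PY
    by_cases h1 : ∀ b, PX b = 0 → Q' b = 0
    · by_cases h2 : ∀ b, PY b = 0 → fstMarginal W' b = 0
      · rw [kl_eq_coe h1, kl_eq_coe h2, ← EReal.coe_mul, ← EReal.coe_add, EReal.coe_le_coe_iff,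
          add_comm (c * _)]
        exact hmin Q' hQ' W' hW' h2 h1
      · rw [kl_eq_coe h1, kl_eq_top h2, ← EReal.coe_mul, EReal.coe_add_top]
        exact le_top
    · rw [kl_eq_top h1, EReal.coe_mul_top_of_pos hc, EReal.top_add_of_ne_bot]
      · exact le_top
      · by_cases h2 : ∀ b, PY b = 0 → fstMarginal W' b = 0
        · rw [kl_eq_coe h2]; exact EReal.coe_ne_bot _
        · rw [kl_eq_top h2]; exact top_ne_bot
  have hev : ∀ v, klReal (fstMarginal W) PY + c * klReal Q PX < v → ∀ᶠ k in atTop,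
      (2 : ℝ) ^ (-(n k * v)) ≤ falseNeg PX PY (optRegion lam c (n k)) (f k) := fun v hv =>
    eventually_le_falseNeg hρ hρ0 hD hlam hc hPX.1 hPY.1 haX haY hn0 hn hN hf hQ hW hWY hQX hv
  have hposFN : ∀ᶠ k in atTop, 0 < falseNeg PX PY (optRegion lam c (n k)) (f k) := by
    filter_upwards [hev _ (lt_add_one _)] with k hk
    exact lt_of_lt_of_le (Real.rpow_pos_of_pos two_pos _) hk
  refine ⟨m, klReal (fstMarginal W) PY + c * klReal Q PX, fun Q hQ => hm Q hQ,
    ⟨⟨Q, hQ, le_antisymm ?_ (hlower Q hQ)⟩, ?_⟩, hposFN, ?_, ?_, ?_⟩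
  · have h := (hm Q hQ).2 ⟨fstMarginal W, by
      rw [gammaInf_eq hρ hρ0 hD hlam hc hQ]; exact Set.mem_image_of_mem _ hW, rfl⟩
    change m Q ≤ kl (fstMarginal W) PY at h
    change (c : EReal) * kl Q PX + m Q ≤ _
    rw [kl_eq_coe hWY] at h
    rw [kl_eq_coe hQX, add_comm (klReal _ _), EReal.coe_add, EReal.coe_mul]
    exact add_le_add le_rfl h
  · rintro _ ⟨Q', hQ', rfl⟩
    exact hlower Q' hQ'
  · refine tendsto_order.2 ⟨fun v hv => ?_, fun v hv => ?_⟩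
    · have h1 : Tendsto (fun k => klReal (fstMarginal W) PY + c * klReal Q PX -
          (lam - threshold 𝒳 lam c (n k))) atTop
          (𝓝 (klReal (fstMarginal W) PY + c * klReal Q PX - (lam - lam))) :=
        (((tendsto_threshold hc).comp hn).const_sub lam).const_sub _
      rw [sub_self, sub_zero] at h1
      filter_upwards [h1.eventually_const_lt hv, hposFN] with k hk hpos
      have hle := falseNeg_le hc hPX.1 hPY.1 (hn0 k) (hN k) (hf k) hmin
      have hnk : (0 : ℝ) < n k := by have := hn0 k; positivity
      rw [← Real.logb_le_iff_le_rpow one_lt_two hpos] at hle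
      rw [lt_div_iff₀ hnk]
      nlinarith
    · obtain ⟨v', hv1, hv2⟩ := exists_between hv
      filter_upwards [hev v' hv1, hposFN] with k hk hpos
      have hnk : (0 : ℝ) < n k := by have := hn0 k; positivity
      rw [← Real.le_logb_iff_rpow_le one_lt_two hpos] at hk
      rw [div_lt_iff₀ hnk]
      nlinarith
  · intro h
    rw [gammaInf_eq hρ hρ0 hD hlam hc hPX] at h
    obtain ⟨W', hW', hW'Y⟩ := h
    have := hmin PX hPX W' hW' (fun b hb => by rw [hW'Y, hb]) fun _ hb => hb
    rw [hW'Y, klReal_self, klReal_self] at this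
    refine le_antisymm (by linarith) (by positivity)
  · intro h
    refine lt_of_le_of_ne (by positivity) fun h0 => h ?_
    -- A zero exponent forces both divergences at the minimizer to vanish, so its pair is `(PY, PX)`
    -- and `PY` would lie in `Γ^∞(PX)`.
    have e1 : klReal (fstMarginal W) PY = 0 := by nlinarith
    have e2 : klReal Q PX = 0 := by
      rw [e1, zero_add, eq_comm, mul_eq_zero] at h0
      exact h0.resolve_left hc.ne'
    rw [← eq_of_klReal_eq_zero hWfst hPY hWY e1, ← eq_of_klReal_eq_zero hQ hPX hQX e2,
      gammaInf_eq hρ hρ0 hD hlam hc hQ]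
    exact Set.mem_image_of_mem _ hW
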